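/- Let $K$ be a field and $\Gamma$ a quiver. The path coalgebra $K\Gamma$ is the vector space with basis all paths of $\Gamma$ (vertices being paths of length $0$), with $\Delta(p)=\sum_{qr=p}q\otimes r$, and $\varepsilon(p)=1$ if $p$ is a vertex, $\varepsilon(p)=0$ otherwise; here $qr$ means $q$ followed by $r$. A path subcoalgebra is a subcoalgebra $C\subseteq K\Gamma$ having a basis $\mathcal B$ of paths ($\mathcal B$ is then the set of all paths lying in $C$), and $C\cap\Gamma$ denotes the subquiver of vertices and arrows of $\Gamma$ lying in $C$. A coalgebra $C$ is left co-Frobenius if it embeds as a left $C^*$-module into its dual algebra $C^*$, where $C^*$ acts on $C$ by $f\cdot c=\sum f(c_2)c_1$. Model quivers: $\mathbb A_\infty$ has vertex set $\mathbb Z$ and one arrow $i\to i+1$ for each $i\in\mathbb Z$; $\mathbb A_{0,\infty}$ has vertex set $\mathbb N=\{0,1,\dots\}$ and one arrow $i\to i+1$ for each $i\in\mathbb N$; for $n\ge1$, $\mathbb C_n$ has vertex set $\mathbb Z/n$ and one arrow $i\to i+1$ for each $i$ (a loop if $n=1$); $\mathbb C_0$ is one vertex without arrows. Model coalgebras: -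 $K[\mathbb A_\infty,r]$, for $r:\mathbb Z\to\mathbb Z$ strictly increasing with $r(n)>n$ for all $n$: the span in $K\mathbb A_\infty$ of the paths of length at most $r(n)-n$ starting at $n$, for all $n$; - $K[\mathbb A_{0,\infty},r]$, for $r:\mathbb N\to\mathbb N$ strictly increasing with $r(0)>0$: the span in $K\mathbb A_{0,\infty}$ of the paths of length at most $r(n)-n$ starting at $n$, for all $n$; - $K[\mathbb C_n,s]$, for $n,s\ge1$: the span in $K\mathbb C_n$ of the paths of length at most $s$; - $K=K\mathbb C_0$. Theorem. Let $C\subseteq K\Gamma$ be a path subcoalgebra with basis of paths $\mathcal B$. Then $C$ is left co-Frobenius if and only if $C\cap\Gamma=\bigsqcup_i\Gamma_i$ is a disjoint union of subquivers of $\Gamma$, each isomorphic to $\mathbb A_\infty$, $\mathbb A_{0,\infty}$ or $\mathbb C_n$ with $n\ge0$, such that the path subcoalgebra $C_i$ of $K\Gamma_i$ spanned by the paths of $\mathcal B$ contained in $\Gamma_i$ is isomorphic to some $K[\mathbb A_\infty,r]$ if $\Gamma_i\cong\mathbb A_\infty$, to some $K[\mathbb A_{0,\infty},r]$ if $\Gamma_i\cong\mathbb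 A_{0,\infty}$, to some $K[\mathbb C_n,s]$ with $s\ge1$ if $\Gamma_i\cong\mathbb C_n$, $n\ge1$, and to $K$ if $\Gamma_i\cong\mathbb C_0$. Moreover, if $C$ is left co-Frobenius, the decomposition and the model coalgebras can be chosen so that for each $i$ some isomorphism of quivers from the model quiver onto $\Gamma_i$ carries the model coalgebra onto $C_i$. For every decomposition as above, $C=\bigoplus_i C_i$ as coalgebras (via the inclusions $K\Gamma_i\subseteq K\Gamma$); in particular, $C$ is isomorphic to the direct sum of the corresponding coalgebras of types $K[\mathbb A_\infty,r]$, $K[\mathbb A_{0,\infty},r]$, $K[\mathbb C_n,s]$ and $K$. -/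

import Mathlib

open scoped TensorProduct

universe u v w x y

/-! ## Subcoalgebras -/

/-- A subcoalgebra of a coalgebra `A` over a field: a subspace `D` with `Δ(D) ⊆ D ⊗ D`, where
`D ⊗ D` is regarded as a subspace of `A ⊗ A`. -/
structure Subcoalgebra (K : Type u) (A : Type v) [Field K] [AddCommGroup A] [Module K A]
    [Coalgebra K A] where
  toSubmodule : Submodule K A
  comul_mem : ∀ a ∈ toSubmodule,
    Coalgebra.comul (R := K) a ∈ LinearMap.range (TensorProduct.mapIncl toSubmodule toSubmodule)

theorem mapIncl_injective {K : Type u} {A : Type v} [Field K] [AddCommGroup A] [Module K A]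
    (p : Submodule K A) :
    Function.Injective (TensorProduct.mapIncl p p) :=
  TensorProduct.map_injective_of_flat_flat _ _ p.injective_subtype p.injective_subtype

namespace Subcoalgebra

variable {K : Type u} {A : Type v} [Field K] [AddCommGroup A] [Module K A] [Coalgebra K A]

/-- The comultiplication of a subcoalgebra, the corestriction of the ambient one. -/
noncomputable def comul (D : Subcoalgebra K A) :
    D.toSubmodule →ₗ[K] D.toSubmodule ⊗[K] D.toSubmodule :=
  (LinearEquiv.ofInjective _ (mapIncl_injective D.toSubmodule)).symm.toLinearMap ∘ₗ
    (Coalgebra.comul ∘ₗ D.toSubmodule.subtype).codRestrict _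
      (fun c => D.comul_mem c.1 c.2)

theorem mapIncl_comp_comul (D : Subcoalgebra K A) :
    TensorProduct.mapIncl D.toSubmodule D.toSubmodule ∘ₗ D.comul =
      Coalgebra.comul ∘ₗ D.toSubmodule.subtype := by
  ext c
  have h := LinearEquiv.apply_symm_apply
    (LinearEquiv.ofInjective _ (mapIncl_injective D.toSubmodule))
    ((Coalgebra.comul ∘ₗ D.toSubmodule.subtype).codRestrict _
      (fun c => D.comul_mem c.1 c.2) c)
  exact congrArg Subtype.val h

/-- A subcoalgebra is a coalgebra with the restricted comultiplication and counit. -/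
noncomputable instance instCoalgebra (D : Subcoalgebra K A) : Coalgebra K D.toSubmodule where
  comul := D.comul
  counit := Coalgebra.counit ∘ₗ D.toSubmodule.subtype
  coassoc := by
    have hinj : Function.Injective
        (TensorProduct.map D.toSubmodule.subtype
          (TensorProduct.map D.toSubmodule.subtype D.toSubmodule.subtype)) :=
      TensorProduct.map_injective_of_flat_flat _ _ D.toSubmodule.injective_subtype
        (mapIncl_injective _)
    have h := D.mapIncl_comp_comul
    rw [TensorProduct.mapIncl] at h
    have h1 : TensorProduct.map D.toSubmodule.subtype
          (TensorProduct.map D.toSubmodule.subtype D.toSubmodule.subtype) ∘ₗ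
          (TensorProduct.assoc K D.toSubmodule D.toSubmodule D.toSubmodule).toLinearMap =
        (TensorProduct.assoc K A A A).toLinearMap ∘ₗ
          TensorProduct.map (TensorProduct.map D.toSubmodule.subtype D.toSubmodule.subtype)
            D.toSubmodule.subtype := by
      ext; rfl
    have h2 : TensorProduct.map (TensorProduct.map D.toSubmodule.subtype D.toSubmodule.subtype)
          D.toSubmodule.subtype ∘ₗ LinearMap.rTensor D.toSubmodule D.comul =
        LinearMap.rTensor A Coalgebra.comul ∘ₗ
          TensorProduct.map D.toSubmodule.subtype D.toSubmodule.subtype := by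
      rw [LinearMap.map_comp_rTensor, h, LinearMap.rTensor_comp_map]
    have h3 : TensorProduct.map D.toSubmodule.subtype
          (TensorProduct.map D.toSubmodule.subtype D.toSubmodule.subtype) ∘ₗ
          LinearMap.lTensor D.toSubmodule D.comul =
        LinearMap.lTensor A Coalgebra.comul ∘ₗ
          TensorProduct.map D.toSubmodule.subtype D.toSubmodule.subtype := by
      rw [LinearMap.map_comp_lTensor, h, LinearMap.lTensor_comp_map]
    rw [← LinearMap.cancel_left hinj]
    simp only [← LinearMap.comp_assoc]
    rw [h1, h3, LinearMap.comp_assoc _ _ (LinearMap.lTensor A _), h,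
      LinearMap.comp_assoc _ (LinearMap.rTensor _ _), LinearMap.comp_assoc,
      ← LinearMap.comp_assoc _ (LinearMap.rTensor _ _), h2, LinearMap.comp_assoc D.comul, h]
    simp only [← LinearMap.comp_assoc]
    rw [← Coalgebra.coassoc]
    simp only [LinearMap.comp_assoc]
  rTensor_counit_comp_comul := by
    have hinj : Function.Injective (LinearMap.lTensor K D.toSubmodule.subtype) :=
      Module.Flat.lTensor_preserves_injective_linearMap _ D.toSubmodule.injective_subtype
    have h := D.mapIncl_comp_comul
    rw [TensorProduct.mapIncl] at h
    have h1 : LinearMap.lTensor K D.toSubmodule.subtype ∘ₗ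
        LinearMap.rTensor D.toSubmodule (Coalgebra.counit ∘ₗ D.toSubmodule.subtype) =
        LinearMap.rTensor A Coalgebra.counit ∘ₗ
          TensorProduct.map D.toSubmodule.subtype D.toSubmodule.subtype := by
      ext; rfl
    rw [← LinearMap.cancel_left hinj, ← LinearMap.comp_assoc, h1, LinearMap.comp_assoc, h,
      ← LinearMap.comp_assoc, Coalgebra.rTensor_counit_comp_comul]
    rfl
  lTensor_counit_comp_comul := by
    have hinj : Function.Injective (LinearMap.rTensor K D.toSubmodule.subtype) :=
      Module.Flat.rTensor_preserves_injective_linearMap _ D.toSubmodule.injective_subtype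
    have h := D.mapIncl_comp_comul
    rw [TensorProduct.mapIncl] at h
    have h1 : LinearMap.rTensor K D.toSubmodule.subtype ∘ₗ
        LinearMap.lTensor D.toSubmodule (Coalgebra.counit ∘ₗ D.toSubmodule.subtype) =
        LinearMap.lTensor A Coalgebra.counit ∘ₗ
          TensorProduct.map D.toSubmodule.subtype D.toSubmodule.subtype := by
      ext; rfl
    rw [← LinearMap.cancel_left hinj, ← LinearMap.comp_assoc, h1, LinearMap.comp_assoc, h,
      ← LinearMap.comp_assoc, Coalgebra.lTensor_counit_comp_comul]
    rfl

end Subcoalgebra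

/-! ## Left co-Frobenius coalgebras -/

section CoFrobenius

variable (K : Type u) (C : Type v) [Field K] [AddCommGroup C] [Module K C] [Coalgebra K C]

/-- The left action of the dual algebra `C^*` (convolution product) on `C`,
`f ⇀ c = ∑ f(c₂) c₁`. -/
noncomputable def dualAction (f : WithConv (C →ₗ[K] K)) : C →ₗ[K] C :=
  (TensorProduct.rid K C).toLinearMap ∘ₗ LinearMap.lTensor C f.ofConv ∘ₗ Coalgebra.comul

variable {K C} in
theorem dualAction_eq_sum {ι : Type*} {c : C} (r : Coalgebra.Repr K c ι)
    (f : WithConv (C →ₗ[K] K)) :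
    dualAction K C f c = ∑ i ∈ r.index, f (r.right i) • r.left i := by
  simp [dualAction, ← r.eq]

/-- The standard left `C^*`-module structure on a coalgebra `C`. -/
@[reducible]
noncomputable def leftDualModule : Module (WithConv (C →ₗ[K] K)) C where
  smul f c := dualAction K C f c
  one_smul c := by
    change dualAction K C 1 c = c
    have h := congrArg (TensorProduct.rid K C) (Coalgebra.lTensor_counit_comul (R := K) c)
    simp only [TensorProduct.rid_tmul, one_smul] at h
    exact h
  mul_smul f g c := by
    change dualAction K C (f * g) c = dualAction K C f (dualAction K C g c)
    let φ : C ⊗[K] (C ⊗[K] C) →ₗ[K] C :=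
      (TensorProduct.rid K C).toLinearMap ∘ₗ LinearMap.lTensor C
        (LinearMap.mul' K K ∘ₗ TensorProduct.map f.ofConv g.ofConv)
    have h := congrArg φ (Coalgebra.coassoc_apply (R := K) c)
    have h1 : dualAction K C (f * g) c =
        φ (LinearMap.lTensor C Coalgebra.comul (Coalgebra.comul c)) := by
      simp only [dualAction, φ, LinearMap.convMul_def, LinearMap.comp_apply,
        LinearMap.lTensor_comp]
    have h2 : dualAction K C f ∘ₗ (TensorProduct.rid K C).toLinearMap ∘ₗ
          LinearMap.lTensor C g.ofConv =
        φ ∘ₗ (TensorProduct.assoc K C C C).toLinearMap ∘ₗ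
          LinearMap.rTensor C Coalgebra.comul := by
      ext a b
      let r := Coalgebra.Repr.arbitrary K a
      simp [dualAction, φ, ← r.eq, TensorProduct.sum_tmul, Finset.smul_sum, smul_smul, mul_comm]
    rw [h1, ← h]
    exact (LinearMap.congr_fun h2 (Coalgebra.comul c)).symm
  smul_zero f := map_zero _
  smul_add f := map_add _
  add_smul f g c := by
    change dualAction K C (f + g) c = dualAction K C f c + dualAction K C g c
    simp [dualAction, LinearMap.lTensor_add]
  zero_smul c := by
    change dualAction K C 0 c = 0
    simp [dualAction]

/-- `C` is left co-Frobenius if it embeds in its dual algebra `C^*` as a left `C^*`-module. -/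
def IsLeftCoFrobenius : Prop :=
  letI := leftDualModule K C
  ∃ φ : C →ₗ[WithConv (C →ₗ[K] K)] WithConv (C →ₗ[K] K), Function.Injective φ

end CoFrobenius

/-! ## Path coalgebras -/

/-- A path of a quiver together with its endpoints; vertices are the paths `nil`. -/
abbrev AllPaths (V : Type v) [Quiver.{w} V] := Σ a : V, Σ b : V, Quiver.Path a b

/-- The path coalgebra `KΓ`: the vector space with basis the set of all paths. -/
def PathCoalgebra (K : Type u) (V : Type v) [Field K] [Quiver.{w} V] := AllPaths V →₀ K

namespace PathCoalgebra

variable (K : Type u) {V : Type v} [Field K] [Quiver.{w} V]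

noncomputable instance : AddCommGroup (PathCoalgebra K V) :=
  inferInstanceAs (AddCommGroup (AllPaths V →₀ K))

noncomputable instance : Module K (PathCoalgebra K V) :=
  inferInstanceAs (Module K (AllPaths V →₀ K))

/-- The basis of `KΓ` consisting of the paths. -/
noncomputable def basis (V : Type v) [Quiver.{w} V] :
    Module.Basis (AllPaths V) K (PathCoalgebra K V) :=
  ⟨LinearEquiv.refl K (AllPaths V →₀ K)⟩

/-- A path as an element of `KΓ`. -/
noncomputable def ofPath {a b : V} (p : Quiver.Path a b) : PathCoalgebra K V :=
  basis K V ⟨a, b, p⟩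

/-- All factorizations `p = q r` of a path. -/
def splits {a : V} : ∀ {b : V}, Quiver.Path a b →
    List (Σ c : V, Quiver.Path a c × Quiver.Path c b)
  | _, .nil => [⟨a, .nil, .nil⟩]
  | b, .cons p e => ⟨b, p.cons e, .nil⟩ :: (splits p).map fun s => ⟨s.1, s.2.1, s.2.2.cons e⟩

theorem mem_splits {a b : V} (p : Quiver.Path a b)
    (s : Σ c : V, Quiver.Path a c × Quiver.Path c b) :
    s ∈ splits p ↔ s.2.1.comp s.2.2 = p := by
  obtain ⟨c, q, r⟩ := s
  induction p with
  | nil =>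
    constructor
    · intro h
      simp only [splits, List.mem_singleton] at h
      cases h
      rfl
    · intro h
      cases r with
      | nil => cases h; simp [splits]
      | cons r e => exact absurd h (Quiver.Path.cons_ne_nil _ _)
  | @cons b b' p e ih =>
    constructor
    · intro h
      simp only [splits, List.mem_cons, List.mem_map] at h
      rcases h with h | ⟨⟨c', q', r'⟩, hs, h⟩
      · cases h; rfl
      · cases h
        exact congrArg (fun t => Quiver.Path.cons t e) ((ih _).1 hs)
    · intro h
      cases r with
      | nil => cases h; simp [splits]
      | cons r e' =>
        simp only [Quiver.Path.comp_cons] at h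
        cases h
        simp only [splits, List.mem_cons, List.mem_map]
        exact Or.inr ⟨⟨_, _, _⟩, (ih _).2 rfl, rfl⟩

theorem nodup_splits {a b : V} (p : Quiver.Path a b) : (splits p).Nodup := by
  induction p with
  | nil => simp [splits]
  | cons p e ih =>
    rw [splits, List.nodup_cons]
    constructor
    · intro h
      obtain ⟨t, -, h⟩ := List.mem_map.1 h
      have h1 := congrArg (fun t => t.2.2.length) h
      simp at h1
    · refine ih.map ?_
      rintro ⟨c, q, r⟩ ⟨c', q', r'⟩ h
      cases h
      rfl

/-- The comultiplication `Δ(p) = ∑_{p = q r} q ⊗ r`. -/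
noncomputable def comul : PathCoalgebra K V →ₗ[K] PathCoalgebra K V ⊗[K] PathCoalgebra K V :=
  (basis K V).constr K fun p =>
    ((splits p.2.2).map fun s => ofPath K s.2.1 ⊗ₜ[K] ofPath K s.2.2).sum

/-- The counit, `1` on vertices and `0` on paths of positive length. -/
noncomputable def counit : PathCoalgebra K V →ₗ[K] K :=
  (basis K V).constr K fun p => if p.2.2.length = 0 then 1 else 0

theorem comul_ofPath {a b : V} (p : Quiver.Path a b) :
    comul K (ofPath K p) =
      ((splits p).map fun s => ofPath K s.2.1 ⊗ₜ[K] ofPath K s.2.2).sum :=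
  (basis K V).constr_basis K _ _

theorem counit_ofPath {a b : V} (p : Quiver.Path a b) :
    counit K (ofPath K p) = if p.length = 0 then 1 else 0 :=
  (basis K V).constr_basis K _ _

theorem sum_splits_splits {M : Type x} [AddCommMonoid M] {a b : V} (p : Quiver.Path a b)
    (f : ∀ c d : V, Quiver.Path a c → Quiver.Path c d → Quiver.Path d b → M) :
    ((splits p).map fun s =>
        ((splits s.2.1).map fun t => f t.1 s.1 t.2.1 t.2.2 s.2.2).sum).sum =
      ((splits p).map fun s =>
        ((splits s.2.2).map fun t => f s.1 t.1 s.2.1 t.2.1 t.2.2).sum).sum := by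
  induction p with
  | nil => simp [splits]
  | cons p e ih =>
    simp only [splits, List.map_cons, List.map_map, Function.comp_def, List.sum_cons,
      List.map_nil, List.sum_nil, add_zero, List.sum_map_add]
    rw [ih fun c d q r t => f c d q r (t.cons e), add_assoc]

theorem sum_splits_left {M : Type x} [AddCommMonoid M] {a b : V} (p : Quiver.Path a b)
    (f : ∀ c : V, Quiver.Path c b → M) :
    ((splits p).map fun s => if s.2.1.length = 0 then f s.1 s.2.2 else 0).sum = f a p := by
  induction p with
  | nil => simp [splits]
  | cons p e ih =>
    simp only [splits, List.map_cons, List.map_map, Function.comp_def, List.sum_cons,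
      Quiver.Path.length_cons]
    rw [ih fun c r => f c (r.cons e)]
    simp

theorem sum_splits_right {M : Type x} [AddCommMonoid M] {a b : V} (p : Quiver.Path a b)
    (f : ∀ c : V, Quiver.Path a c → M) :
    ((splits p).map fun s => if s.2.2.length = 0 then f s.1 s.2.1 else 0).sum = f b p := by
  cases p with
  | nil => simp [splits]
  | cons p e => simp [splits, Function.comp_def]

theorem sum_tmul {M N : Type*} [AddCommGroup M] [Module K M] [AddCommGroup N] [Module K N]
    (l : List M) (n : N) : l.sum ⊗ₜ[K] n = (l.map fun m => m ⊗ₜ[K] n).sum := by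
  induction l with
  | nil => simp
  | cons m l ih => simp [TensorProduct.add_tmul, ih]

theorem tmul_sum {M N : Type*} [AddCommGroup M] [Module K M] [AddCommGroup N] [Module K N]
    (l : List N) (m : M) : m ⊗ₜ[K] l.sum = (l.map fun n => m ⊗ₜ[K] n).sum := by
  induction l with
  | nil => simp
  | cons n l ih => simp [TensorProduct.tmul_add, ih]

noncomputable instance : Coalgebra K (PathCoalgebra K V) where
  comul := comul K
  counit := counit K
  coassoc := by
    refine (basis K V).ext ?_
    rintro ⟨a, b, p⟩
    change TensorProduct.assoc K _ _ _ (LinearMap.rTensor _ (comul K) (comul K (ofPath K p))) =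
      LinearMap.lTensor _ (comul K) (comul K (ofPath K p))
    simp only [comul_ofPath, map_list_sum, List.map_map, Function.comp_def,
      LinearMap.rTensor_tmul, LinearMap.lTensor_tmul]
    have h := sum_splits_splits p fun c d q r t =>
      ofPath K q ⊗ₜ[K] (ofPath K r ⊗ₜ[K] ofPath K t)
    simp only [sum_tmul, tmul_sum, map_list_sum, List.map_map, Function.comp_def,
      TensorProduct.assoc_tmul]
    exact h
  rTensor_counit_comp_comul := by
    refine (basis K V).ext ?_
    rintro ⟨a, b, p⟩
    change LinearMap.rTensor _ (counit K) (comul K (ofPath K p)) = 1 ⊗ₜ[K] ofPath K p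
    simp only [comul_ofPath, map_list_sum, List.map_map, Function.comp_def,
      LinearMap.rTensor_tmul, counit_ofPath]
    have h := sum_splits_left p fun c r => (1 : K) ⊗ₜ[K] ofPath K r
    rw [← h]
    congr 2
    funext s
    split_ifs <;> simp
  lTensor_counit_comp_comul := by
    refine (basis K V).ext ?_
    rintro ⟨a, b, p⟩
    change LinearMap.lTensor _ (counit K) (comul K (ofPath K p)) = ofPath K p ⊗ₜ[K] 1
    simp only [comul_ofPath, map_list_sum, List.map_map, Function.comp_def,
      LinearMap.lTensor_tmul, counit_ofPath]
    have h := sum_splits_right p fun c q => ofPath K q ⊗ₜ[K] (1 : K)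
    rw [← h]
    congr 2
    funext s
    split_ifs <;> simp

/-- The linear map `KΓ → KΓ'` induced by a morphism of quivers. -/
noncomputable def map {V' : Type x} [Quiver.{y} V'] (F : V ⥤q V') :
    PathCoalgebra K V →ₗ[K] PathCoalgebra K V' :=
  (basis K V).constr K fun p => ofPath K (F.mapPath p.2.2)

variable {K} in
theorem factors_mem (C : Subcoalgebra K (PathCoalgebra K V)) {a b c : V} (q : Quiver.Path a b)
    (r : Quiver.Path b c) (h : ofPath K (q.comp r) ∈ C.toSubmodule) :
    ofPath K q ∈ C.toSubmodule ∧ ofPath K r ∈ C.toSubmodule := by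
  classical
  have hmem : (⟨b, q, r⟩ : Σ d : V, Quiver.Path a d × Quiver.Path d c) ∈ splits (q.comp r) :=
    (mem_splits _ _).2 rfl
  have huniq : ∀ t ∈ splits (q.comp r),
      (⟨a, t.1, t.2.1⟩ : AllPaths V) = ⟨a, b, q⟩ ∨ (⟨t.1, c, t.2.2⟩ : AllPaths V) = ⟨b, c, r⟩ →
        t = ⟨b, q, r⟩ := by
    rintro ⟨d, q', r'⟩ ht h
    have ht' := (mem_splits _ _).1 ht
    rcases h with h | h
    · cases h
      have := (Quiver.Path.comp_inj_right).1 ht'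
      cases this
      rfl
    · cases h
      have := (Quiver.Path.comp_inj_left).1 ht'
      cases this
      rfl
  have hΔ := C.comul_mem _ h
  have hsum : Coalgebra.comul (R := K) (ofPath K (q.comp r)) =
      ∑ t ∈ (splits (q.comp r)).toFinset, ofPath K t.2.1 ⊗ₜ[K] ofPath K t.2.2 := by
    rw [List.sum_toFinset _ (nodup_splits _)]
    exact comul_ofPath K _
  have hcoord : ∀ s t : AllPaths V, (basis K V).coord s (ofPath K t.2.2) =
      if t = s then (1 : K) else 0 := by
    intro s t
    rw [Module.Basis.coord_apply]
    exact (basis K V).repr_self_apply t s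
  constructor
  · have key : ∀ z ∈ LinearMap.range (TensorProduct.mapIncl C.toSubmodule C.toSubmodule),
        TensorProduct.rid K _ (LinearMap.lTensor _ ((basis K V).coord ⟨b, c, r⟩) z) ∈
          C.toSubmodule := by
      rintro _ ⟨z, rfl⟩
      induction z with
      | zero => simp
      | tmul x y => simpa using C.toSubmodule.smul_mem _ x.2
      | add x y hx hy => simpa using C.toSubmodule.add_mem hx hy
    have h1 := key _ hΔ
    rw [hsum, map_sum, map_sum, Finset.sum_eq_single ⟨b, q, r⟩] at h1
    · simpa [hcoord _ ⟨b, c, r⟩] using h1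
    · intro t ht hne
      have h2 := hcoord ⟨b, c, r⟩ ⟨t.1, c, t.2.2⟩
      rw [if_neg fun h => hne (huniq t (List.mem_toFinset.1 ht) (Or.inr h))] at h2
      simp only [LinearMap.lTensor_tmul, TensorProduct.rid_tmul]
      rw [h2, zero_smul]
    · exact fun h => absurd (List.mem_toFinset.2 hmem) h
  · have key : ∀ z ∈ LinearMap.range (TensorProduct.mapIncl C.toSubmodule C.toSubmodule),
        TensorProduct.lid K _ (LinearMap.rTensor _ ((basis K V).coord ⟨a, b, q⟩) z) ∈
          C.toSubmodule := by
      rintro _ ⟨z, rfl⟩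
      induction z with
      | zero => simp
      | tmul x y => simpa using C.toSubmodule.smul_mem _ y.2
      | add x y hx hy => simpa using C.toSubmodule.add_mem hx hy
    have h1 := key _ hΔ
    rw [hsum, map_sum, map_sum, Finset.sum_eq_single ⟨b, q, r⟩] at h1
    · simpa [hcoord _ ⟨a, b, q⟩] using h1
    · intro t ht hne
      have h2 := hcoord ⟨a, b, q⟩ ⟨a, t.1, t.2.1⟩
      rw [if_neg fun h => hne (huniq t (List.mem_toFinset.1 ht) (Or.inl h))] at h2
      simp only [LinearMap.rTensor_tmul, TensorProduct.lid_tmul]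
      rw [h2, zero_smul]
    · exact fun h => absurd (List.mem_toFinset.2 hmem) h

/-- A set of paths is closed under subpaths. -/
def SubpathClosed (S : Set (AllPaths V)) : Prop :=
  ∀ ⦃a b c : V⦄ (q : Quiver.Path a b) (r : Quiver.Path b c),
    (⟨a, c, q.comp r⟩ : AllPaths V) ∈ S →
      (⟨a, b, q⟩ : AllPaths V) ∈ S ∧ (⟨b, c, r⟩ : AllPaths V) ∈ S

/-- The path subcoalgebra spanned by a set of paths which is closed under subpaths. -/
noncomputable def spanPaths (S : Set (AllPaths V)) (hS : SubpathClosed S) :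
    Subcoalgebra K (PathCoalgebra K V) where
  toSubmodule := Submodule.span K ((fun p => ofPath K p.2.2) '' S)
  comul_mem := by
    intro x hx
    induction hx using Submodule.span_induction with
    | zero => simp
    | add x y _ _ hx hy => rw [map_add]; exact Submodule.add_mem _ hx hy
    | smul k x _ hx => rw [map_smul]; exact Submodule.smul_mem _ k hx
    | mem x hx =>
      obtain ⟨⟨a, b, p⟩, hp, rfl⟩ := hx
      change comul K (ofPath K p) ∈ _
      rw [comul_ofPath]
      refine list_sum_mem ?_
      intro z hz
      obtain ⟨t, ht, rfl⟩ := List.mem_map.1 hz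
      have ht' := (mem_splits _ _).1 ht
      subst ht'
      obtain ⟨h1, h2⟩ := hS _ _ hp
      exact ⟨⟨_, Submodule.subset_span ⟨_, h1, rfl⟩⟩ ⊗ₜ[K] ⟨_, Submodule.subset_span ⟨_, h2, rfl⟩⟩,
        rfl⟩

end PathCoalgebra

open PathCoalgebra

section PathSubcoalgebra

variable {K : Type u} {V : Type v} [Field K] [Quiver.{w} V]

/-- A path subcoalgebra: a subcoalgebra of `KΓ` which is spanned by a set `B` of paths. (Distinct
paths are linearly independent, so such paths form a basis, and `B` is the set of all paths
which belong to the subcoalgebra.) -/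
def IsPathSubcoalgebra (C : Subcoalgebra K (PathCoalgebra K V)) : Prop :=
  ∃ B : Set (AllPaths V), C.toSubmodule = Submodule.span K ((fun p => ofPath K p.2.2) '' B)

theorem ofPath_mem_iff (C : Subcoalgebra K (PathCoalgebra K V)) (B : Set (AllPaths V))
    (hB : C.toSubmodule = Submodule.span K ((fun p => ofPath K p.2.2) '' B)) (p : AllPaths V) :
    ofPath K p.2.2 ∈ C.toSubmodule ↔ p ∈ B := by
  have h : ofPath K p.2.2 ∈ Submodule.span K (basis K V '' B) ↔ p ∈ B := by
    rw [Module.Basis.mem_span_image]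
    change (↑((basis K V).repr (basis K V p)).support : Set (AllPaths V)) ⊆ B ↔ p ∈ B
    rw [Module.Basis.repr_self, Finsupp.support_single p (one_ne_zero (α := K))]
    simp
  rw [hB]
  exact h

end PathSubcoalgebra

/-! ## Subquivers -/

/-- A subquiver: a set of vertices, and a set of arrows whose endpoints are among them. -/
@[ext]
structure Subquiver (V : Type v) [Quiver.{w} V] where
  verts : Set V
  arrows : ∀ a b : V, Set (a ⟶ b)
  src_mem : ∀ {a b : V} {e : a ⟶ b}, e ∈ arrows a b → a ∈ verts
  tgt_mem : ∀ {a b : V} {e : a ⟶ b}, e ∈ arrows a b → b ∈ verts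

namespace Subquiver

variable {V : Type v} [Quiver.{w} V]

/-- The vertices of a subquiver, as a type. -/
def Vert (H : Subquiver V) : Type v := {a : V // a ∈ H.verts}

/-- A subquiver is itself a quiver. -/
instance (H : Subquiver V) : Quiver.{w} H.Vert where
  Hom a b := {e : a.1 ⟶ b.1 // e ∈ H.arrows a.1 b.1}

/-- The inclusion of a subquiver. -/
def incl (H : Subquiver V) : H.Vert ⥤q V where
  obj a := a.1
  map e := e.1

/-- `G` is the disjoint union of the subquivers `H i`. -/
structure IsDisjointUnion {ι : Type x} (G : Subquiver V) (H : ι → Subquiver V) : Prop where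
  disjoint : ∀ i j, i ≠ j → Disjoint (H i).verts (H j).verts
  verts_eq : G.verts = ⋃ i, (H i).verts
  arrows_eq : ∀ a b : V, G.arrows a b = ⋃ i, (H i).arrows a b

end Subquiver

/-- A morphism of quivers which is bijective on vertices and on arrows. -/
structure IsQuiverIso {V : Type v} {V' : Type x} [Quiver.{w} V] [Quiver.{y} V'] (F : V ⥤q V') :
    Prop where
  bijective_obj : Function.Bijective F.obj
  bijective_map : ∀ a b : V, Function.Bijective (F.map : (a ⟶ b) → (F.obj a ⟶ F.obj b))

namespace Subcoalgebra

variable {K : Type u} {V : Type v} [Field K] [Quiver.{w} V]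

/-- The subquiver `C ∩ Γ` of the vertices and arrows of `Γ` which belong to `C`. -/
def subquiver (C : Subcoalgebra K (PathCoalgebra K V)) : Subquiver V where
  verts := {a | ofPath K (Quiver.Path.nil : Quiver.Path a a) ∈ C.toSubmodule}
  arrows a b := {e | ofPath K (Quiver.Hom.toPath e) ∈ C.toSubmodule}
  src_mem {a b e} h := by
    refine (factors_mem C Quiver.Path.nil (Quiver.Hom.toPath e) ?_).1
    rwa [Quiver.Path.nil_comp]
  tgt_mem {a b e} h := (factors_mem C (Quiver.Hom.toPath e) Quiver.Path.nil h).2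

/-- For a subquiver `H` of `Γ`, the path subcoalgebra of `KH` spanned by the paths of `C` which are
contained in `H`. -/
noncomputable def component (C : Subcoalgebra K (PathCoalgebra K V)) (H : Subquiver V) :
    Subcoalgebra K (PathCoalgebra K H.Vert) :=
  spanPaths K {p | ofPath K (H.incl.mapPath p.2.2) ∈ C.toSubmodule} (by
    intro a b c q r h
    refine factors_mem C _ _ ?_
    rw [← Prefunctor.mapPath_comp]
    exact h)

end Subcoalgebra

/-! ## The model quivers and coalgebras -/

/-- The vertices of the quiver `A_∞`: the integers. -/
structure LineQuiver : Type where
  idx : ℤ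

/-- `A_∞` has one arrow from `i` to `i + 1` for every integer `i`. -/
instance : Quiver.{0} LineQuiver where
  Hom i j := PLift (j.idx = i.idx + 1)

/-- The vertices of the quiver `A_{0,∞}`: the natural numbers. -/
structure RayQuiver : Type where
  idx : ℕ

/-- `A_{0,∞}` has one arrow from `i` to `i + 1` for every natural number `i`. -/
instance : Quiver.{0} RayQuiver where
  Hom i j := PLift (j.idx = i.idx + 1)

/-- The vertices of the cyclic quiver `C_n`, `n ≥ 1`: the integers modulo `n`. -/
structure CycleQuiver (n : ℕ) : Type where
  idx : ZMod n

/-- `C_n` has one arrow from `i` to `i + 1` for every `i` in `ℤ/n`; for `n = 1` it is a loop. -/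
instance (n : ℕ) : Quiver.{0} (CycleQuiver n) where
  Hom i j := PLift (j.idx = i.idx + 1)

/-- The vertex of the quiver `C_0`. -/
inductive PointQuiver : Type
  | pt

/-- `C_0` has no arrows. -/
instance : Quiver.{0} PointQuiver where
  Hom _ _ := PEmpty

theorem LineQuiver.tgt_eq {a b : LineQuiver} (p : Quiver.Path a b) :
    b.idx = a.idx + (p.length : ℤ) := by
  induction p with
  | nil => simp
  | cons p e ih =>
    have h := e.down
    rw [Quiver.Path.length_cons]
    push_cast
    linarith

theorem RayQuiver.tgt_eq {a b : RayQuiver} (p : Quiver.Path a b) :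
    b.idx = a.idx + p.length := by
  induction p with
  | nil => rfl
  | cons p e ih =>
    have h := e.down
    rw [Quiver.Path.length_cons]
    omega

/-- The coalgebra `K[A_∞, r]`: the span of the paths `p` of `A_∞` with
`length(p) ≤ r(n) - n`, where `n` is the source of `p`. -/
noncomputable def lineCoalgebra (K : Type u) [Field K] (r : ℤ → ℤ) (hr : StrictMono r) :
    Subcoalgebra K (PathCoalgebra K LineQuiver) :=
  spanPaths K {p | (p.2.2.length : ℤ) ≤ r p.1.idx - p.1.idx} (by
    intro a b c p q h
    have h1 := LineQuiver.tgt_eq p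
    have h' : ((p.comp q).length : ℤ) ≤ r a.idx - a.idx := h
    rw [Quiver.Path.length_comp] at h'
    push_cast at h'
    change (p.length : ℤ) ≤ r a.idx - a.idx ∧ (q.length : ℤ) ≤ r b.idx - b.idx
    have h2 : r a.idx ≤ r b.idx := hr.monotone (by omega)
    omega)

/-- The coalgebra `K[A_{0,∞}, r]`: the span of the paths `p` of `A_{0,∞}` with
`length(p) ≤ r(n) - n`, that is `n + length(p) ≤ r(n)`, where `n` is the source of `p`. -/
noncomputable def rayCoalgebra (K : Type u) [Field K] (r : ℕ → ℕ) (hr : StrictMono r) :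
    Subcoalgebra K (PathCoalgebra K RayQuiver) :=
  spanPaths K {p | p.1.idx + p.2.2.length ≤ r p.1.idx} (by
    intro a b c p q h
    have h1 := RayQuiver.tgt_eq p
    have h' : a.idx + (p.comp q).length ≤ r a.idx := h
    rw [Quiver.Path.length_comp] at h'
    change a.idx + p.length ≤ r a.idx ∧ b.idx + q.length ≤ r b.idx
    have h2 : r a.idx ≤ r b.idx := hr.monotone (by omega)
    omega)

/-- The coalgebra `K[C_n, s]`: the span of the paths of `C_n` of length at most `s`. -/
noncomputable def cycleCoalgebra (K : Type u) [Field K] (n s : ℕ) :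
    Subcoalgebra K (PathCoalgebra K (CycleQuiver n)) :=
  spanPaths K {p | p.2.2.length ≤ s} (by
    intro a b c p q h
    have h' : (p.comp q).length ≤ s := h
    rw [Quiver.Path.length_comp] at h'
    exact ⟨show p.length ≤ s by omega, show q.length ≤ s by omega⟩)

/-- The one-dimensional coalgebra `K`, as the path coalgebra of `C_0`. -/
noncomputable def pointCoalgebra (K : Type u) [Field K] :
    Subcoalgebra K (PathCoalgebra K PointQuiver) :=
  spanPaths K Set.univ (fun _ _ _ _ _ _ => ⟨trivial, trivial⟩)

/-- The types of components: `K[A_∞, r]`, `K[A_{0,∞}, r]`, `K[C_n, s]` and `K`. -/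
inductive ModelType : Type
  | line (r : ℤ → ℤ) (hr : StrictMono r) (hlt : ∀ n, n < r n)
  | ray (r : ℕ → ℕ) (hr : StrictMono r) (hpos : 0 < r 0)
  | cycle (n s : ℕ) (hn : 1 ≤ n) (hs : 1 ≤ s)
  | point

namespace ModelType

/-- The vertices of the model quiver: `A_∞`, `A_{0,∞}`, `C_n` or `C_0`. -/
def Vert : ModelType → Type
  | line _ _ _ => LineQuiver
  | ray _ _ _ => RayQuiver
  | cycle n _ _ _ => CycleQuiver n
  | point => PointQuiver

/-- The model quiver. -/
instance instQuiver : (t : ModelType) → Quiver.{0} t.Vert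
  | line _ _ _ => inferInstanceAs (Quiver.{0} LineQuiver)
  | ray _ _ _ => inferInstanceAs (Quiver.{0} RayQuiver)
  | cycle n _ _ _ => inferInstanceAs (Quiver.{0} (CycleQuiver n))
  | point => inferInstanceAs (Quiver.{0} PointQuiver)

/-- The model path subcoalgebra of the path coalgebra of the model quiver. -/
noncomputable def coalgebra (K : Type u) [Field K] :
    (t : ModelType) → Subcoalgebra K (PathCoalgebra K t.Vert)
  | line r hr _ => lineCoalgebra K r hr
  | ray r hr _ => rayCoalgebra K r hr
  | cycle n s _ _ => cycleCoalgebra K n s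
  | point => pointCoalgebra K

end ModelType

/-- `C ∩ Γ` is the disjoint union of the subquivers `H i`, where `H i` is isomorphic to the model
quiver of type `t i`, and the span `C_i` of the paths of `C` contained in `H i` is isomorphic to
the model coalgebra of type `t i`. -/
structure IsDecomposition {K : Type u} {V : Type v} [Field K] [Quiver.{w} V]
    (C : Subcoalgebra K (PathCoalgebra K V)) {ι : Type x} (H : ι → Subquiver V)
    (t : ι → ModelType) : Prop where
  disjointUnion : C.subquiver.IsDisjointUnion H
  quiver_type : ∀ i, ∃ F : (t i).Vert ⥤q (H i).Vert, IsQuiverIso F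
  coalgebra_type : ∀ i, Nonempty
    ((C.component (H i)).toSubmodule ≃ₗc[K] ((t i).coalgebra K).toSubmodule)

/-!
Let `S` be the set of paths of the path subcoalgebra `C`; it is closed under subpaths and is a basis
of `C`. An embedding of `C` into `C^*` is a balanced bilinear form `B` with `B(c, -) ≠ 0` for
`c ≠ 0` (`isLeftCoFrobenius_iff`). Balancedness against the coordinate functional of a path `r` says
`B(p₁, q) = B(p, q')` whenever `p = p₁ r` and `q = r q'`, with the value `0` if only one of the two
factorizations exists. Starting from `B(a, Q) ≠ 0` for a vertex `a`, this shows that `Q` starts at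
`a`, that every path of `S` starting at `a` is a prefix of `Q`, and that every path of `S` ending
where `Q` does is a suffix of `Q` (`hasDominatingPaths_of_isLeftCoFrobenius`). Conversely, such
dominating paths `Q a` define a balanced form, with `B(p, q) = 1` if `p q` is a dominating path and
`0` otherwise (`isLeftCoFrobenius_of_hasDominatingPaths`).

If dominating paths exist, each vertex has at most one outgoing and at most one incoming arrow, and
a vertex with an incoming arrow has an outgoing one. Hence passing to the next vertex is an
injective map on the vertices of `C`, and its orbits are rays, lines, cycles and isolated vertices.
The paths in an orbit which belong to `S` are those not longer than the dominating path at their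
source (`map_incl_mem_iff`), and the length of the dominating path does not decrease along arrows
(`PathCoalgebra.SubpathClosed.length_le_length`). On a ray or a line this makes
`r n = n + length (Q n)` strictly increasing, and on a cycle it makes the length constant, so that
the component is a model coalgebra (`exists_modelType`).

In the other direction, if `C ∩ Γ` is a disjoint union of subquivers, the paths of `C` are the paths
of the components, so that `C` is their direct sum (`exists_directSum_equiv`). The model coalgebras
have dominating paths, and being left co-Frobenius is inherited by direct sums
(`IsLeftCoFrobenius.dfinsupp`) and by isomorphic coalgebras.
-/

/-! ### Coalgebra maps into subcoalgebras -/

namespace Subcoalgebra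

variable {K : Type u} {A : Type v} [Field K] [AddCommGroup A] [Module K A] [Coalgebra K A]

/-- The inclusion of a subcoalgebra is a map of coalgebras. -/
noncomputable def subtypeHom (D : Subcoalgebra K A) : D.toSubmodule →ₗc[K] A where
  __ := D.toSubmodule.subtype
  counit_comp := rfl
  map_comp_comul := D.mapIncl_comp_comul

/-- A map of coalgebras whose values lie in a subcoalgebra, with restricted codomain. -/
noncomputable def codRestrictHom {X : Type*} [AddCommGroup X] [Module K X] [Coalgebra K X]
    (D : Subcoalgebra K A) (g : X →ₗc[K] A) (hg : ∀ c, g c ∈ D.toSubmodule) :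
    X →ₗc[K] D.toSubmodule where
  __ := g.toLinearMap.codRestrict D.toSubmodule hg
  counit_comp := g.counit_comp
  map_comp_comul := by
    change TensorProduct.map (g.toLinearMap.codRestrict D.toSubmodule hg)
      (g.toLinearMap.codRestrict D.toSubmodule hg) ∘ₗ CoalgebraStruct.comul =
      D.comul ∘ₗ g.toLinearMap.codRestrict D.toSubmodule hg
    rw [← LinearMap.cancel_left (mapIncl_injective D.toSubmodule), ← LinearMap.comp_assoc,
      ← LinearMap.comp_assoc, D.mapIncl_comp_comul, TensorProduct.mapIncl, ← TensorProduct.map_comp]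
    exact g.map_comp_comul

theorem toSubmodule_injective :
    Function.Injective (toSubmodule : Subcoalgebra K A → Submodule K A) := by
  rintro ⟨D, _⟩ ⟨E, _⟩ h
  cases h
  rfl

/-- An injective map of coalgebras identifies a subcoalgebra with its image. -/
theorem nonempty_equiv_of_map_eq {A' : Type*} [AddCommGroup A'] [Module K A'] [Coalgebra K A']
    (g : A →ₗc[K] A') (hg : Function.Injective g) (D : Subcoalgebra K A) (E : Subcoalgebra K A')
    (h : E.toSubmodule = D.toSubmodule.map g.toLinearMap) :
    Nonempty (E.toSubmodule ≃ₗc[K] D.toSubmodule) := by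
  have hmem : ∀ c, g.comp D.subtypeHom c ∈ E.toSubmodule := fun c => by
    rw [h]
    exact ⟨c, c.2, rfl⟩
  refine ⟨(CoalgEquiv.ofBijective (f := E.codRestrictHom (g.comp D.subtypeHom) hmem)
    ⟨fun c d hcd => ?_, fun e => ?_⟩).symm⟩
  · exact Subtype.ext (hg (congrArg Subtype.val hcd))
  · obtain ⟨c, hc, hce⟩ : (e : A') ∈ D.toSubmodule.map g.toLinearMap := h ▸ e.2
    exact ⟨⟨c, hc⟩, Subtype.ext hce⟩

end Subcoalgebra

/-! ### Balanced bilinear forms and left co-Frobenius coalgebras -/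

section Balanced

variable {K : Type u} [Field K]
  {C : Type*} [AddCommGroup C] [Module K C] [Coalgebra K C]
  {D : Type*} [AddCommGroup D] [Module K D] [Coalgebra K D]

/-- A bilinear form `B` on a coalgebra `C` is balanced if `c ↦ B(c, -)` is a map of left
`C^*`-modules `C → C^*`. -/
def IsBalanced (B : C →ₗ[K] C →ₗ[K] K) : Prop :=
  ∀ (f : C →ₗ[K] K) (c d : C), B (dualAction K C (.toConv f) c) d =
    (WithConv.toConv f * WithConv.toConv (B c)) d

theorem dualAction_smul_one (k : K) (c : C) : dualAction K C (k • 1) c = k • c := by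
  have h := congrArg (TensorProduct.rid K C) (Coalgebra.lTensor_counit_comul (R := K) c)
  simp only [TensorProduct.rid_tmul, one_smul] at h
  have h1 : (k • (1 : WithConv (C →ₗ[K] K))).ofConv = k • CoalgebraStruct.counit := by
    ext; simp
  rw [dualAction, h1, LinearMap.lTensor_smul]
  simp only [LinearMap.comp_apply, LinearMap.smul_apply, map_smul]
  exact congrArg (k • ·) h

/-- A map of left `C^*`-modules `C → C^*` is the same thing as a balanced bilinear form, because
scalars act through the multiples of the counit. -/
theorem isLeftCoFrobenius_iff :
    IsLeftCoFrobenius K C ↔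
      ∃ B : C →ₗ[K] C →ₗ[K] K, Function.Injective B ∧ IsBalanced B := by
  let := leftDualModule K C
  constructor
  · rintro ⟨φ, hφ⟩
    let B : C →ₗ[K] C →ₗ[K] K :=
      { toFun c := (φ c).ofConv
        map_add' c d := by rw [map_add]; rfl
        map_smul' k c := by
          have h := φ.map_smul (k • (1 : WithConv (C →ₗ[K] K))) c
          have h1 : (k • (1 : WithConv (C →ₗ[K] K))) • c = k • c := dualAction_smul_one k c
          rw [h1] at h
          rw [h, smul_eq_mul, smul_one_mul]
          rfl }
    refine ⟨B, fun c d h => hφ (WithConv.ofConv_injective h), fun f c d => ?_⟩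
    exact congrArg (fun g : WithConv (C →ₗ[K] K) => g d) (φ.map_smul (WithConv.toConv f) c)
  · rintro ⟨B, hB, hbal⟩
    refine ⟨{ toFun c := .toConv (B c)
              map_add' c d := by rw [map_add]; rfl
              map_smul' f c := ?_ }, fun c d h => hB (WithConv.toConv_injective h)⟩
    exact WithConv.ext (LinearMap.ext (hbal f.ofConv c))

theorem CoalgHom.dualAction_comp (h : C →ₗc[K] D) (f : D →ₗ[K] K) (c : C) :
    h (dualAction K C (.toConv (f ∘ₗ h.toLinearMap)) c) = dualAction K D (.toConv f) (h c) := by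
  simp only [dualAction, LinearMap.comp_apply]
  rw [← CoalgHomClass.map_comp_comul_apply h c]
  generalize CoalgebraStruct.comul (R := K) c = z
  induction z with
  | zero => simp
  | tmul a b => simp
  | add a b ha hb => simp only [map_add] at *; rw [ha, hb]

theorem CoalgHom.convMul_apply_comp (h : C →ₗc[K] D) (f g : D →ₗ[K] K) (c : C) :
    (WithConv.toConv f * WithConv.toConv g) (h c) =
      (WithConv.toConv (f ∘ₗ h.toLinearMap) * WithConv.toConv (g ∘ₗ h.toLinearMap)) c :=
  LinearMap.congr_fun (LinearMap.convMul_comp_coalgHom_distrib (.toConv f) (.toConv g) h) c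

theorem IsLeftCoFrobenius.of_equiv (e : C ≃ₗc[K] D) (hD : IsLeftCoFrobenius K D) :
    IsLeftCoFrobenius K C := by
  obtain ⟨B, hB, hbal⟩ := isLeftCoFrobenius_iff.1 hD
  let h : C →ₗc[K] D := e
  refine isLeftCoFrobenius_iff.2 ⟨B.compl₁₂ h.toLinearMap h.toLinearMap, fun c d hcd => ?_,
    fun f c d => ?_⟩
  · refine e.injective (hB (LinearMap.ext fun x => ?_))
    simpa [h] using LinearMap.congr_fun hcd (e.symm x)
  · obtain ⟨g, rfl⟩ : ∃ g : D →ₗ[K] K, f = g ∘ₗ h.toLinearMap :=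
      ⟨f ∘ₗ e.symm.toLinearMap, LinearMap.ext fun c => by simp [h]⟩
    change B (h _) (h d) = _
    rw [CoalgHom.dualAction_comp, hbal, CoalgHom.convMul_apply_comp]
    rfl

variable {ι : Type*} [DecidableEq ι] {A : ι → Type*} [∀ i, AddCommGroup (A i)]
  [∀ i, Module K (A i)] [∀ i, Coalgebra K (A i)]

/-- The inclusion of a summand of a direct sum of coalgebras. -/
noncomputable def DFinsupp.lsingleHom (i : ι) : A i →ₗc[K] Π₀ i, A i where
  __ := DFinsupp.lsingle i
  counit_comp := DFinsupp.counit_comp_lsingle K ι A i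
  map_comp_comul := (DFinsupp.comul_comp_lsingle K ι A i).symm

@[simp]
theorem DFinsupp.lsingleHom_apply (i : ι) (a : A i) :
    DFinsupp.lsingleHom (K := K) i a = DFinsupp.single i a := rfl

/-- A linear map on a direct sum of coalgebras is a map of coalgebras if its restriction to each
summand is one. -/
noncomputable def DFinsupp.coalgHomOfSingle (g : (Π₀ i, A i) →ₗ[K] C) (h : ∀ i, A i →ₗc[K] C)
    (hg : ∀ i a, g (DFinsupp.single i a) = h i a) : (Π₀ i, A i) →ₗc[K] C where
  __ := g
  counit_comp := by
    refine DFinsupp.lhom_ext' fun i => LinearMap.ext fun a => ?_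
    simp [hg]
  map_comp_comul := by
    have hgi : ∀ i, g ∘ₗ DFinsupp.lsingle i = (h i).toLinearMap := fun i => LinearMap.ext (hg i)
    refine DFinsupp.lhom_ext' fun i => ?_
    rw [LinearMap.comp_assoc, LinearMap.comp_assoc, DFinsupp.comul_comp_lsingle, hgi,
      ← LinearMap.comp_assoc, ← TensorProduct.map_comp, hgi]
    exact (h i).map_comp_comul

/-- A direct sum of left co-Frobenius coalgebras is left co-Frobenius, through the orthogonal sum
of the balanced forms. -/
theorem IsLeftCoFrobenius.dfinsupp (hA : ∀ i, IsLeftCoFrobenius K (A i)) :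
    IsLeftCoFrobenius K (Π₀ i, A i) := by
  choose B hB hbal using fun i => isLeftCoFrobenius_iff.1 (hA i)
  let Φ : (Π₀ i, A i) →ₗ[K] (Π₀ i, A i) →ₗ[K] K :=
    DFinsupp.lsum K fun i => (B i).compr₂ LinearMap.id |>.compl₂ (DFinsupp.lapply i)
  have hΦ : ∀ c i (b : A i), Φ c (DFinsupp.single i b) = B i (c i) b := by
    intro c i b
    induction c using DFinsupp.induction with
    | h0 => simp
    | ha j a c _ _ ih =>
      rw [map_add, LinearMap.add_apply, ih, DFinsupp.add_apply, map_add, LinearMap.add_apply]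
      congr 1
      by_cases hij : i = j
      · subst hij
        simp [Φ]
      · simp [Φ, DFinsupp.single_apply, hij, Ne.symm hij]
  refine isLeftCoFrobenius_iff.2 ⟨Φ, fun c d hcd => ?_, fun f c d => ?_⟩
  · refine DFinsupp.ext fun i => hB i (LinearMap.ext fun b => ?_)
    rw [← hΦ, ← hΦ, hcd]
  · have hact : ∀ (i : ι), (dualAction K (Π₀ i, A i) (.toConv f) c) i =
        dualAction K (A i) (.toConv (f ∘ₗ DFinsupp.lsingle i)) (c i) := by
      intro i
      induction c using DFinsupp.induction with
      | h0 => simp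
      | ha j a c _ _ ih =>
        rw [map_add, DFinsupp.add_apply, DFinsupp.add_apply, map_add, ih]
        congr 1
        have h := CoalgHom.dualAction_comp (DFinsupp.lsingleHom (K := K) j) f a
        simp only [DFinsupp.lsingleHom_apply] at h
        rw [← h]
        by_cases hij : i = j
        · subst hij
          rw [DFinsupp.single_eq_same, DFinsupp.single_eq_same]
          rfl
        · rw [DFinsupp.single_eq_of_ne hij, DFinsupp.single_eq_of_ne hij, map_zero]
    suffices h : Φ (dualAction K _ (.toConv f) c) =
        (WithConv.toConv f * WithConv.toConv (Φ c)).ofConv from LinearMap.congr_fun h d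
    refine DFinsupp.lhom_ext' fun i => LinearMap.ext fun b => ?_
    have h1 : Φ c ∘ₗ (DFinsupp.lsingleHom (K := K) i).toLinearMap = B i (c i) :=
      LinearMap.ext (hΦ c i)
    have h2 := CoalgHom.convMul_apply_comp (DFinsupp.lsingleHom (K := K) i) f (Φ c) b
    rw [h1] at h2
    change Φ _ (DFinsupp.single i b) = (WithConv.toConv f * WithConv.toConv (Φ c))
      (DFinsupp.lsingleHom (K := K) i b)
    rw [hΦ, h2, hact]
    exact hbal i _ _ _

/-- Isomorphisms between the summands give an isomorphism of direct sums of coalgebras. -/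
theorem nonempty_dfinsupp_equiv {A' : ι → Type*} [∀ i, AddCommGroup (A' i)]
    [∀ i, Module K (A' i)] [∀ i, Coalgebra K (A' i)] (e : ∀ i, A i ≃ₗc[K] A' i) :
    Nonempty ((Π₀ i, A i) ≃ₗc[K] Π₀ i, A' i) := by
  let E : (Π₀ i, A i) ≃ₗ[K] Π₀ i, A' i :=
    DFinsupp.mapRange.linearEquiv fun i => (e i).toLinearEquiv
  let F := DFinsupp.coalgHomOfSingle E.toLinearMap
    (fun i => (DFinsupp.lsingleHom i).comp (e i : A i →ₗc[K] A' i))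
    (fun i a => by simp [E, DFinsupp.mapRange_single])
  exact ⟨CoalgEquiv.ofBijective (f := F) E.bijective⟩

end Balanced

/-! ### Factorizations of paths -/

section Factorizations

variable {V : Type v} [Quiver.{w} V]

/-- The trivial path at a vertex. -/
def AllPaths.vertex (a : V) : AllPaths V := ⟨a, a, .nil⟩

/-- The length of a path. -/
def AllPaths.length (p : AllPaths V) : ℕ := p.2.2.length

theorem AllPaths.eq_vertex_of_length {p : AllPaths V} (h : p.length = 0) : p = .vertex p.1 := by
  obtain ⟨a, b, p⟩ := p
  cases p with
  | nil => rfl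
  | cons p e => simp [AllPaths.length] at h

/-- `IsComp q r p` says that the path `p` is the composite `q r`, that is `q` followed by `r`. As a
relation between paths with unspecified endpoints it avoids transport along equalities of
vertices. -/
inductive IsComp : AllPaths V → AllPaths V → AllPaths V → Prop
  | intro {a b c : V} (q : Quiver.Path a b) (r : Quiver.Path b c) :
    IsComp ⟨a, b, q⟩ ⟨b, c, r⟩ ⟨a, c, q.comp r⟩

namespace IsComp

variable {p q r s q' r' : AllPaths V}

theorem length_eq (h : IsComp q r p) : p.length = q.length + r.length := by
  obtain ⟨q, r⟩ := h
  exact Quiver.Path.length_comp q r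

theorem src_eq (h : IsComp q r p) : q.1 = p.1 := by
  cases h; rfl

theorem mid_eq (h : IsComp q r p) : r.1 = q.2.1 := by
  cases h; rfl

theorem tgt_eq (h : IsComp q r p) : r.2.1 = p.2.1 := by
  cases h; rfl

theorem vertex_left (p : AllPaths V) : IsComp (.vertex p.1) p p := by
  obtain ⟨a, b, p⟩ := p
  have h := IsComp.intro Quiver.Path.nil p
  rwa [Quiver.Path.nil_comp] at h

theorem vertex_right (p : AllPaths V) : IsComp p (.vertex p.2.1) p :=
  IsComp.intro p.2.2 Quiver.Path.nil

theorem left_unique (h : IsComp q r p) (h' : IsComp q' r p) : q = q' := by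
  obtain ⟨q, r⟩ := h
  generalize hp : (⟨_, _, q.comp r⟩ : AllPaths V) = p at h'
  generalize hr : (⟨_, _, r⟩ : AllPaths V) = r' at h'
  obtain ⟨q', r'⟩ := h'
  cases hr
  injection hp with h1 h2
  subst h1
  injection eq_of_heq h2 with h3 h4
  cases Quiver.Path.comp_inj_left.1 h4
  rfl

theorem right_unique (h : IsComp q r p) (h' : IsComp q r' p) : r = r' := by
  obtain ⟨q, r⟩ := h
  generalize hp : (⟨_, _, q.comp r⟩ : AllPaths V) = p at h'
  generalize hr : (⟨_, _, q⟩ : AllPaths V) = q' at h'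
  obtain ⟨q', r'⟩ := h'
  cases hr
  injection hp with h1 h2
  injection h2 with h3 h4
  subst h3
  cases Quiver.Path.comp_inj_right.1 (eq_of_heq h4)
  rfl

theorem comp_unique {p' : AllPaths V} (h : IsComp q r p) (h' : IsComp q r p') : p = p' := by
  obtain ⟨q, r⟩ := h
  generalize hq : (⟨_, _, q⟩ : AllPaths V) = q' at h'
  generalize hr : (⟨_, _, r⟩ : AllPaths V) = r' at h'
  obtain ⟨q', r'⟩ := h'
  cases hq
  cases hr
  rfl

theorem exists_comp (h : r.1 = q.2.1) : ∃ p, IsComp q r p := by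
  obtain ⟨a, b, q⟩ := q
  obtain ⟨b', c, r⟩ := r
  cases h
  exact ⟨_, .intro q r⟩

/-- Associativity: if `p = q r` and `q = q' s`, then `p = q' (s r)`. -/
theorem assoc (h : IsComp q r p) (h' : IsComp q' s q) : ∃ t, IsComp s r t ∧ IsComp q' t p := by
  obtain ⟨q', s⟩ := h'
  generalize hq : (⟨_, _, q'.comp s⟩ : AllPaths V) = q at h
  obtain ⟨q, r⟩ := h
  cases hq
  exact ⟨_, .intro s r, by rw [Quiver.Path.comp_assoc]; exact .intro _ _⟩

/-- Associativity: if `p = q r` and `r = s r'`, then `p = (q s) r'`. -/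
theorem assoc' (h : IsComp q r p) (h' : IsComp s r' r) : ∃ t, IsComp q s t ∧ IsComp t r' p := by
  obtain ⟨s, r'⟩ := h'
  generalize hr : (⟨_, _, s.comp r'⟩ : AllPaths V) = r at h
  obtain ⟨q, r⟩ := h
  cases hr
  exact ⟨_, .intro q s, by rw [← Quiver.Path.comp_assoc]; exact .intro _ _⟩

end IsComp

theorem Quiver.Path.exists_eq_comp_of_length_le {a b c d : V} (p : Quiver.Path a b)
    (x : Quiver.Path b d) (p' : Quiver.Path a c) (x' : Quiver.Path c d)
    (h : p.comp x = p'.comp x') (hl : p.length ≤ p'.length) :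
    ∃ y : Quiver.Path b c, p' = p.comp y ∧ x = y.comp x' := by
  induction x' with
  | nil => exact ⟨x, h.symm, rfl⟩
  | cons x' e ih =>
    cases x with
    | nil =>
      have := congrArg Quiver.Path.length h
      simp at this
      omega
    | cons x e' =>
      simp only [Quiver.Path.comp_cons] at h
      cases Quiver.Path.obj_eq_of_cons_eq_cons h
      cases Quiver.Path.hom_heq_of_cons_eq_cons h
      obtain ⟨y, h1, h2⟩ := ih x (eq_of_heq (Quiver.Path.heq_of_cons_eq_cons h))
      exact ⟨y, h1, by rw [h2, Quiver.Path.comp_cons]⟩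

/-- Of two prefixes of the same path, the shorter one is a prefix of the longer one. -/
theorem IsComp.exists_prefix {p x p' x' s : AllPaths V} (h : IsComp p x s) (h' : IsComp p' x' s)
    (hl : p.length ≤ p'.length) : ∃ y, IsComp p y p' := by
  obtain ⟨p, x⟩ := h
  generalize hs : (⟨_, _, p.comp x⟩ : AllPaths V) = s at h'
  obtain ⟨p', x'⟩ := h'
  injection hs with h1 h2
  subst h1
  injection eq_of_heq h2 with h3 h4
  subst h3
  obtain ⟨y, rfl, -⟩ := p.exists_eq_comp_of_length_le x p' x' (eq_of_heq h4) hl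
  exact ⟨_, .intro p y⟩

theorem IsComp.eq_of_prefix_of_length_eq {p x p' : AllPaths V} (h : IsComp p x p')
    (hl : p.length = p'.length) : p = p' := by
  have h1 := h.length_eq
  have h2 := AllPaths.eq_vertex_of_length (p := x) (by omega)
  have h3 := h.mid_eq
  rw [h2, h3] at h
  exact (IsComp.vertex_right p).comp_unique h

theorem IsComp.eq_of_suffix_of_length_eq {p x p' : AllPaths V} (h : IsComp x p p')
    (hl : p.length = p'.length) : p = p' := by
  have h1 := h.length_eq
  have h2 := AllPaths.eq_vertex_of_length (p := x) (by omega)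
  have h3 := h.mid_eq
  rw [h2] at h h3
  have h4 : p.1 = x.1 := h3
  rw [← h4] at h
  exact (IsComp.vertex_left p).comp_unique h

open Classical in
/-- The finite set of all factorizations of a path. -/
noncomputable def factorizations (p : AllPaths V) : Finset (AllPaths V × AllPaths V) :=
  ((splits p.2.2).map fun s => ((⟨p.1, s.1, s.2.1⟩, ⟨s.1, p.2.1, s.2.2⟩) :
    AllPaths V × AllPaths V)).toFinset

theorem mem_factorizations {p : AllPaths V} {x : AllPaths V × AllPaths V} :
    x ∈ factorizations p ↔ IsComp x.1 x.2 p := by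
  classical
  obtain ⟨a, b, p⟩ := p
  simp only [factorizations, List.mem_toFinset, List.mem_map]
  constructor
  · rintro ⟨⟨c, q, r⟩, hs, rfl⟩
    rw [mem_splits] at hs
    subst hs
    exact .intro q r
  · obtain ⟨x, y⟩ := x
    intro h
    generalize hp : (⟨a, b, p⟩ : AllPaths V) = p' at h
    obtain ⟨q, r⟩ := h
    cases hp
    exact ⟨⟨_, q, r⟩, (mem_splits _ _).2 rfl, rfl⟩

theorem sum_splits_eq {M : Type*} [AddCommMonoid M] (p : AllPaths V)
    (f : AllPaths V → AllPaths V → M) :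
    ((splits p.2.2).map fun s => f ⟨p.1, s.1, s.2.1⟩ ⟨s.1, p.2.1, s.2.2⟩).sum =
      ∑ x ∈ factorizations p, f x.1 x.2 := by
  classical
  rw [factorizations, List.sum_toFinset, List.map_map]
  · rfl
  · refine (nodup_splits _).map ?_
    rintro ⟨c, q, r⟩ ⟨c', q', r'⟩ h
    cases h
    rfl

end Factorizations

/-! ### Path subcoalgebras and their bases -/

section PathBasis

variable (K : Type u) {V : Type v} [Field K] [Quiver.{w} V]

theorem PathCoalgebra.comul_basis (p : AllPaths V) :
    CoalgebraStruct.comul (R := K) (basis K V p) =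
      ∑ x ∈ factorizations p, basis K V x.1 ⊗ₜ[K] basis K V x.2 := by
  rw [← sum_splits_eq p fun q r => basis K V q ⊗ₜ[K] basis K V r]
  exact comul_ofPath K p.2.2

theorem length_mapPath {V' : Type x} [Quiver.{y} V'] (F : V ⥤q V') {a b : V}
    (p : Quiver.Path a b) : (F.mapPath p).length = p.length := by
  induction p with
  | nil => rfl
  | cons p e ih => simp [ih]

theorem splits_mapPath {V' : Type x} [Quiver.{y} V'] (F : V ⥤q V') {a b : V}
    (p : Quiver.Path a b) :
    splits (F.mapPath p) =
      (splits p).map fun s => ⟨F.obj s.1, F.mapPath s.2.1, F.mapPath s.2.2⟩ := by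
  induction p with
  | nil => rfl
  | cons p e ih => simp [splits, ih]

/-- Every morphism of quivers induces a map of path coalgebras: the factorizations of the image of
a path are the images of its factorizations. -/
noncomputable def PathCoalgebra.mapHom {V' : Type x} [Quiver.{y} V'] (F : V ⥤q V') :
    PathCoalgebra K V →ₗc[K] PathCoalgebra K V' where
  __ := PathCoalgebra.map K F
  counit_comp := by
    refine (basis K V).ext fun p => ?_
    have h : PathCoalgebra.map K F (basis K V p) = ofPath K (F.mapPath p.2.2) :=
      (basis K V).constr_basis K _ _
    change counit K (PathCoalgebra.map K F (basis K V p)) = counit K (ofPath K p.2.2)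
    rw [h, counit_ofPath, counit_ofPath, length_mapPath]
  map_comp_comul := by
    have h : ∀ {a b} (p : Quiver.Path a b), PathCoalgebra.map K F (ofPath K p) =
      ofPath K (F.mapPath p) := fun p => (basis K V).constr_basis K _ _
    refine (basis K V).ext fun p => ?_
    change TensorProduct.map (PathCoalgebra.map K F) (PathCoalgebra.map K F)
      (comul K (ofPath K p.2.2)) = comul K (PathCoalgebra.map K F (ofPath K p.2.2))
    rw [h, comul_ofPath, comul_ofPath, splits_mapPath, map_list_sum, List.map_map, List.map_map]
    congr 2
    funext s
    simp [h]

theorem PathCoalgebra.map_ofPath {V' : Type x} [Quiver.{y} V'] (F : V ⥤q V') {a b : V}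
    (p : Quiver.Path a b) :
    PathCoalgebra.map K F (ofPath K p) = ofPath K (F.mapPath p) :=
  (basis K V).constr_basis K _ _

variable {K} in
/-- The paths which belong to a subcoalgebra. -/
def Subcoalgebra.paths (C : Subcoalgebra K (PathCoalgebra K V)) : Set (AllPaths V) :=
  {p | ofPath K p.2.2 ∈ C.toSubmodule}

variable {S : Set (AllPaths V)} (hS : SubpathClosed S)

theorem mem_paths_spanPaths (p : AllPaths V) : p ∈ (spanPaths K S hS).paths ↔ p ∈ S :=
  ofPath_mem_iff (spanPaths K S hS) S rfl p

variable {K} in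
theorem IsPathSubcoalgebra.eq_spanPaths {C : Subcoalgebra K (PathCoalgebra K V)}
    (hC : IsPathSubcoalgebra C) :
    ∃ (S : Set (AllPaths V)) (hS : SubpathClosed S), C = spanPaths K S hS := by
  obtain ⟨S, hS⟩ := hC
  have hmem := ofPath_mem_iff C S hS
  refine ⟨S, fun a b c q r h => ?_, Subcoalgebra.toSubmodule_injective hS⟩
  have := factors_mem C q r ((hmem _).2 h)
  exact ⟨(hmem _).1 this.1, (hmem _).1 this.2⟩

theorem PathCoalgebra.SubpathClosed.left {S : Set (AllPaths V)} (hS : SubpathClosed S)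
    {q r p : AllPaths V} (h : IsComp q r p) (hp : p ∈ S) : q ∈ S := by
  obtain ⟨q, r⟩ := h
  exact (hS q r hp).1

theorem PathCoalgebra.SubpathClosed.right {S : Set (AllPaths V)} (hS : SubpathClosed S)
    {q r p : AllPaths V} (h : IsComp q r p) (hp : p ∈ S) : r ∈ S := by
  obtain ⟨q, r⟩ := h
  exact (hS q r hp).2

open Classical in
/-- The basis of a path subcoalgebra which consists of its paths. -/
noncomputable def spanPathsBasis : Module.Basis S K (spanPaths K S hS).toSubmodule :=
  (Module.Basis.span ((basis K V).linearIndependent.comp _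
    (Subtype.val_injective (p := (· ∈ S))))).map (LinearEquiv.ofEq _ _ (by
      change _ = Submodule.span K ((fun p => ofPath K p.2.2) '' S)
      rw [Set.range_comp, Subtype.range_coe]
      rfl))

theorem coe_spanPathsBasis (p : S) :
    (spanPathsBasis K hS p : PathCoalgebra K V) = basis K V p.1 := by
  rw [spanPathsBasis, Module.Basis.map_apply]
  exact congrArg Subtype.val (Module.Basis.span_apply ((basis K V).linearIndependent.comp _
    (Subtype.val_injective (p := (· ∈ S)))) p)

open Classical in
/-- A path as an element of a path subcoalgebra, with value `0` if it does not belong to it. -/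
noncomputable def pathIn (p : AllPaths V) : (spanPaths K S hS).toSubmodule :=
  if h : p ∈ S then spanPathsBasis K hS ⟨p, h⟩ else 0

theorem pathIn_of_mem {p : AllPaths V} (hp : p ∈ S) :
    pathIn K hS p = spanPathsBasis K hS ⟨p, hp⟩ := dif_pos hp

theorem comul_pathIn {p : AllPaths V} (hp : p ∈ S) :
    CoalgebraStruct.comul (R := K) (pathIn K hS p) =
      ∑ x ∈ factorizations p, pathIn K hS x.1 ⊗ₜ[K] pathIn K hS x.2 := by
  refine mapIncl_injective _ ?_
  have h := LinearMap.congr_fun (spanPaths K S hS).mapIncl_comp_comul (pathIn K hS p)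
  refine h.trans ?_
  rw [LinearMap.comp_apply, Submodule.subtype_apply, pathIn_of_mem K hS hp, coe_spanPathsBasis,
    comul_basis, map_sum]
  refine Finset.sum_congr rfl fun x hx => ?_
  have hx := mem_factorizations.1 hx
  rw [pathIn_of_mem K hS (hS.left hx hp), pathIn_of_mem K hS (hS.right hx hp)]
  simp [TensorProduct.mapIncl, coe_spanPathsBasis]

theorem dualAction_pathIn (f : (spanPaths K S hS).toSubmodule →ₗ[K] K) {p : AllPaths V}
    (hp : p ∈ S) :
    dualAction K _ (.toConv f) (pathIn K hS p) =
      ∑ x ∈ factorizations p, f (pathIn K hS x.2) • pathIn K hS x.1 := by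
  simp only [dualAction, LinearMap.comp_apply]
  rw [comul_pathIn K hS hp]
  simp

theorem convMul_pathIn (f g : (spanPaths K S hS).toSubmodule →ₗ[K] K) {p : AllPaths V}
    (hp : p ∈ S) :
    (WithConv.toConv f * WithConv.toConv g) (pathIn K hS p) =
      ∑ x ∈ factorizations p, f (pathIn K hS x.1) * g (pathIn K hS x.2) := by
  rw [LinearMap.convMul_apply, comul_pathIn K hS hp]
  simp

end PathBasis

/-! ### The combinatorial form of the co-Frobenius condition -/

section Criterion

variable {K : Type u} {V : Type v} [Field K] [Quiver.{w} V]

/-- The path `Q` of `S` starts at the vertex `a`, the paths of `S` starting at `a` are prefixes of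
`Q`, and the paths of `S` with the same end as `Q` are suffixes of `Q`. -/
structure IsDominating (S : Set (AllPaths V)) (a : V) (Q : AllPaths V) : Prop where
  mem : Q ∈ S
  src : Q.1 = a
  prefix_of_src : ∀ p ∈ S, p.1 = a → ∃ x, IsComp p x Q
  suffix_of_tgt : ∀ p ∈ S, p.2.1 = Q.2.1 → ∃ x, IsComp x p Q

/-- For every vertex `a` of `S` there is a path `Q` in `S` which dominates the paths of `S` starting
at `a` and the paths of `S` ending where `Q` does. -/
def HasDominatingPaths (S : Set (AllPaths V)) : Prop :=
  ∀ a, AllPaths.vertex a ∈ S → ∃ Q, IsDominating S a Q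

variable {S : Set (AllPaths V)} (hS : SubpathClosed S)

/-- If `B` is a balanced form with injective `c ↦ B(c, -)` and `a` is a vertex, then
`B(a, Q) ≠ 0` for some path `Q`. Moving prefixes of `Q` from the right to the left argument shows
that `Q` dominates all paths which start at `a` or end where `Q` does. -/
theorem hasDominatingPaths_of_isLeftCoFrobenius
    (h : IsLeftCoFrobenius K (spanPaths K S hS).toSubmodule) : HasDominatingPaths S := by
  classical
  obtain ⟨B, hB, hbal⟩ := isLeftCoFrobenius_iff.1 h
  let b := spanPathsBasis K hS
  have hcoord : ∀ (r : S), ∀ p ∈ S, b.coord r (pathIn K hS p) = if p = r.1 then 1 else 0 := by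
    intro r p hp
    rw [pathIn_of_mem K hS hp, Module.Basis.coord_apply, b.repr_self_apply]
    simp only [Subtype.ext_iff]
  -- Balancedness against the coordinate functional of the path `r`.
  have key : ∀ r ∈ S, ∀ p ∈ S, ∀ q ∈ S,
      (∑ x ∈ factorizations p, if x.2 = r then B (pathIn K hS x.1) (pathIn K hS q) else 0) =
        ∑ x ∈ factorizations q, if x.1 = r then B (pathIn K hS p) (pathIn K hS x.2) else 0 := by
    intro r hr p hp q hq
    have h1 := hbal (b.coord ⟨r, hr⟩) (pathIn K hS p) (pathIn K hS q)
    rw [convMul_pathIn K hS _ _ hq, dualAction_pathIn K hS _ hp, map_sum,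
      LinearMap.sum_apply] at h1
    convert h1 using 1
    · refine Finset.sum_congr rfl fun x hx => ?_
      rw [hcoord _ _ (hS.right (mem_factorizations.1 hx) hp)]
      split_ifs <;> simp
    · refine Finset.sum_congr rfl fun x hx => ?_
      rw [hcoord _ _ (hS.left (mem_factorizations.1 hx) hq)]
      split_ifs <;> simp
  -- Moving a suffix `r` of `p` to the right argument, if `B(p₁, q) ≠ 0`.
  have key_left : ∀ {p₁ r p q : AllPaths V}, p ∈ S → q ∈ S → IsComp p₁ r p →
      B (pathIn K hS p₁) (pathIn K hS q) ≠ 0 →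
      ∃ q', IsComp r q' q ∧
        B (pathIn K hS p) (pathIn K hS q') = B (pathIn K hS p₁) (pathIn K hS q) := by
    intro p₁ r p q hp hq hc hne
    have h1 := key r (hS.right hc hp) p hp q hq
    rw [Finset.sum_eq_single (p₁, r), if_pos rfl] at h1
    · obtain ⟨x, hx, hx'⟩ := Finset.exists_ne_zero_of_sum_ne_zero (h1 ▸ hne)
      have hxr : x.1 = r := by
        by_contra hxr
        exact hx' (if_neg hxr)
      rw [mem_factorizations, hxr] at hx
      refine ⟨x.2, hx, ?_⟩
      rw [h1, Finset.sum_eq_single x, if_pos hxr]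
      · intro y hy hne
        refine if_neg fun hyr => hne ?_
        rw [mem_factorizations, hyr] at hy
        exact Prod.ext (hyr.trans hxr.symm) (hy.right_unique hx)
      · exact fun hx' => absurd (mem_factorizations.2 (hxr ▸ hx)) hx'
    · rintro ⟨y₁, y₂⟩ hy hne
      refine if_neg fun hyr => hne ?_
      rw [mem_factorizations] at hy
      obtain rfl : y₂ = r := hyr
      exact Prod.ext (hy.left_unique hc) rfl
    · exact fun hx' => absurd (mem_factorizations.2 hc) hx'
  -- A prefix `r` of `q` can be moved to the left argument only if `p` ends with `r`.
  have key_right : ∀ {r q' p q : AllPaths V}, p ∈ S → q ∈ S → IsComp r q' q →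
      B (pathIn K hS p) (pathIn K hS q') ≠ 0 → ∃ p', IsComp p' r p := by
    intro r q' p q hp hq hc hne
    have h1 := (key r (hS.left hc hq) p hp q hq).symm
    rw [Finset.sum_eq_single (r, q'), if_pos rfl] at h1
    · obtain ⟨x, hx, hx'⟩ := Finset.exists_ne_zero_of_sum_ne_zero (h1 ▸ hne)
      have hxr : x.2 = r := by
        by_contra hxr
        exact hx' (if_neg hxr)
      rw [mem_factorizations, hxr] at hx
      exact ⟨x.1, hx⟩
    · rintro ⟨y₁, y₂⟩ hy hne
      refine if_neg fun hyr => hne ?_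
      rw [mem_factorizations] at hy
      obtain rfl : y₁ = r := hyr
      exact Prod.ext rfl (hy.right_unique hc)
    · exact fun hx' => absurd (mem_factorizations.2 hc) hx'
  intro a ha
  obtain ⟨Q, hQ, hne⟩ : ∃ Q ∈ S, B (pathIn K hS (.vertex a)) (pathIn K hS Q) ≠ 0 := by
    by_contra! hzero
    have h1 : B (pathIn K hS (.vertex a)) = B 0 := by
      rw [map_zero]
      refine b.ext fun q => ?_
      rw [← pathIn_of_mem K hS q.2, hzero q.1 q.2, LinearMap.zero_apply]
    have h2 := hB h1
    rw [pathIn_of_mem K hS ha] at h2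
    exact b.ne_zero _ h2
  have hpre : ∀ p ∈ S, p.1 = a → ∃ x, IsComp p x Q ∧
      B (pathIn K hS p) (pathIn K hS x) = B (pathIn K hS (.vertex a)) (pathIn K hS Q) := by
    rintro p hp rfl
    exact key_left hp hQ (IsComp.vertex_left p) hne
  have hsrc : Q.1 = a := by
    obtain ⟨x, hx, -⟩ := hpre _ ha rfl
    exact hx.src_eq.symm
  refine ⟨Q, hQ, hsrc, fun p hp hpa => ?_, fun p hp hpt => ?_⟩
  · obtain ⟨x, hx, -⟩ := hpre p hp hpa
    exact ⟨x, hx⟩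
  · obtain ⟨x, hx, hB'⟩ := hpre Q hQ hsrc
    have hx' : x = .vertex p.2.1 := by
      rw [hpt]
      exact hx.right_unique (IsComp.vertex_right Q)
    rw [hx'] at hB'
    exact key_right hQ hp (IsComp.vertex_right p) (hB' ▸ hne)

/-- Conversely, if the paths `Q a` dominate, then the form with `B(p, q) = 1` if `p q` is one of the
paths `Q a`, and `B(p, q) = 0` otherwise, is balanced and every path `p` has a partner `q` with
`B(p', q) ≠ 0` only for `p' = p`. -/
theorem isLeftCoFrobenius_of_hasDominatingPaths (h : HasDominatingPaths S) :
    IsLeftCoFrobenius K (spanPaths K S hS).toSubmodule := by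
  classical
  have hsrc : ∀ p ∈ S, AllPaths.vertex p.1 ∈ S := fun p hp => hS.left (IsComp.vertex_left p) hp
  have h' : ∀ a, ∃ Q, AllPaths.vertex a ∈ S → IsDominating S a Q := fun a =>
    if ha : AllPaths.vertex a ∈ S then (h a ha).imp fun _ hQ _ => hQ
    else ⟨.vertex a, fun ha' => absurd ha' ha⟩
  choose Q hQ using h'
  let b := spanPathsBasis K hS
  let β : AllPaths V → AllPaths V → K := fun p q => if IsComp p q (Q p.1) then 1 else 0
  let B : (spanPaths K S hS).toSubmodule →ₗ[K] (spanPaths K S hS).toSubmodule →ₗ[K] K :=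
    b.constr K fun p => b.constr K fun q => β p q
  have hB : ∀ p ∈ S, ∀ q ∈ S, B (pathIn K hS p) (pathIn K hS q) = β p q := by
    intro p hp q hq
    rw [pathIn_of_mem K hS hp, pathIn_of_mem K hS hq]
    simp only [B]
    rw [b.constr_basis, b.constr_basis]
  -- `p₁ r = p` and `p₁ q = Q a` force `q = r q'`, and then `p q' = Q a`.
  have hforth : ∀ {p₁ r p q}, p ∈ S → IsComp p₁ r p → IsComp p₁ q (Q p₁.1) →
      ∃ q', IsComp r q' q ∧ IsComp p q' (Q p.1) := by
    intro p₁ r p q hp h1 h2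
    obtain ⟨q', h3⟩ := (hQ _ (hsrc p hp)).prefix_of_src p hp rfl
    obtain ⟨t, h4, h5⟩ := h3.assoc h1
    rw [h1.src_eq] at h2
    exact ⟨q', (h5.right_unique h2) ▸ h4, h3⟩
  have hback : ∀ {r q' p q}, p ∈ S → q ∈ S → IsComp r q' q → IsComp p q' (Q p.1) →
      ∃ p₁, IsComp p₁ r p ∧ IsComp p₁ q (Q p₁.1) := by
    intro r q' p q hp hq h1 h2
    obtain ⟨p₁, h3⟩ := (hQ _ (hsrc p hp)).suffix_of_tgt q hq (h1.tgt_eq.symm.trans h2.tgt_eq)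
    obtain ⟨t, h4, h5⟩ := h3.assoc' h1
    obtain rfl := h5.left_unique h2
    exact ⟨p₁, h4, by rwa [h4.src_eq]⟩
  refine isLeftCoFrobenius_iff.2 ⟨B, ?_, ?_⟩
  · refine (injective_iff_map_eq_zero B).2 fun c hc => ?_
    refine b.ext_elem fun p => ?_
    obtain ⟨q, hq⟩ := (hQ _ (hsrc _ p.2)).prefix_of_src p.1 p.2 rfl
    have hqS : q ∈ S := hS.right hq (hQ _ (hsrc _ p.2)).mem
    have hcoord : B.flip (pathIn K hS q) = b.coord p := by
      refine b.ext fun p' => ?_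
      rw [LinearMap.flip_apply, ← pathIn_of_mem K hS p'.2, hB _ p'.2 _ hqS,
        Module.Basis.coord_apply, pathIn_of_mem K hS p'.2, b.repr_self_apply]
      refine if_congr ⟨fun h' => Subtype.ext ?_, fun h' => congrArg Subtype.val h' ▸ hq⟩ rfl rfl
      -- `Q (s p)` and `Q (s p')` have the same end, so each is a suffix of the other.
      have ht := hq.tgt_eq.symm.trans h'.tgt_eq
      have hD := hQ _ (hsrc _ p.2)
      have hD' := hQ _ (hsrc _ p'.2)
      obtain ⟨x, hx⟩ := hD.suffix_of_tgt _ hD'.mem ht.symm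
      obtain ⟨y, hy⟩ := hD'.suffix_of_tgt _ hD.mem ht
      have hl := hx.length_eq
      have hl' := hy.length_eq
      have hQQ := hx.eq_of_suffix_of_length_eq (by omega)
      rw [hQQ] at h'
      exact h'.left_unique hq
    rw [map_zero, Finsupp.zero_apply, ← Module.Basis.coord_apply, ← hcoord, LinearMap.flip_apply]
    exact LinearMap.congr_fun hc _
  · intro f
    suffices h : B ∘ₗ dualAction K _ (.toConv f) =
        { toFun c := (WithConv.toConv f * WithConv.toConv (B c)).ofConv
          map_add' c d := by rw [map_add, WithConv.toConv_add, mul_add]; rfl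
          map_smul' k c := by
            rw [map_smul, WithConv.toConv_smul, mul_smul_comm]; rfl } from
      fun c d => LinearMap.congr_fun (LinearMap.congr_fun h c) d
    refine b.ext fun p => b.ext fun q => ?_
    obtain ⟨p, hp⟩ := p
    obtain ⟨q, hq⟩ := q
    rw [← pathIn_of_mem K hS hp, ← pathIn_of_mem K hS hq]
    change B (dualAction K _ (.toConv f) (pathIn K hS p)) (pathIn K hS q) =
      (WithConv.toConv f * WithConv.toConv (B (pathIn K hS p))) (pathIn K hS q)
    rw [convMul_pathIn K hS _ _ hq, dualAction_pathIn K hS _ hp, map_sum, LinearMap.sum_apply]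
    have h1 : ∀ x ∈ factorizations p,
        B (f (pathIn K hS x.2) • pathIn K hS x.1) (pathIn K hS q) =
          if IsComp x.1 q (Q x.1.1) then f (pathIn K hS x.2) else 0 := by
      intro x hx
      rw [map_smul, LinearMap.smul_apply, hB _ (hS.left (mem_factorizations.1 hx) hp) _ hq,
        smul_eq_mul]
      simp only [β, mul_ite, mul_one, mul_zero]
    have h2 : ∀ x ∈ factorizations q,
        f (pathIn K hS x.1) * B (pathIn K hS p) (pathIn K hS x.2) =
          if IsComp p x.2 (Q p.1) then f (pathIn K hS x.1) else 0 := by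
      intro x hx
      rw [hB _ hp _ (hS.right (mem_factorizations.1 hx) hq)]
      simp only [β, mul_ite, mul_one, mul_zero]
    rw [Finset.sum_congr rfl h1, Finset.sum_congr rfl h2, ← Finset.sum_filter,
      ← Finset.sum_filter]
    -- The terms are matched by `(p₁, r) ↔ (r, q')`, where `p₁ r = p` and `r q' = q`.
    have : Nonempty (AllPaths V) := ⟨p⟩
    refine Finset.sum_bij' (i := fun x _ => (x.2, Classical.epsilon fun q' => IsComp x.2 q' q))
      (j := fun x _ => (Classical.epsilon fun p₁ => IsComp p₁ x.1 p, x.1)) ?_ ?_ ?_ ?_ ?_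
    · rintro ⟨p₁, r⟩ hx
      simp only [Finset.mem_filter, mem_factorizations] at hx ⊢
      obtain ⟨q', h3, h4⟩ := hforth hp hx.1 hx.2
      have h5 : IsComp r (Classical.epsilon fun q' => IsComp r q' q) q :=
        Classical.epsilon_spec (p := fun q' => IsComp r q' q) ⟨q', h3⟩
      exact ⟨h5, (h3.right_unique h5) ▸ h4⟩
    · rintro ⟨r, q'⟩ hx
      simp only [Finset.mem_filter, mem_factorizations] at hx ⊢
      obtain ⟨p₁, h3, h4⟩ := hback hp hq hx.1 hx.2
      have h5 : IsComp (Classical.epsilon fun p₁ => IsComp p₁ r p) r p :=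
        Classical.epsilon_spec (p := fun p₁ => IsComp p₁ r p) ⟨p₁, h3⟩
      exact ⟨h5, (h3.left_unique h5) ▸ h4⟩
    · rintro ⟨p₁, r⟩ hx
      simp only [Finset.mem_filter, mem_factorizations] at hx
      have h5 : IsComp (Classical.epsilon fun p₁ => IsComp p₁ r p) r p :=
        Classical.epsilon_spec (p := fun p₁ => IsComp p₁ r p) ⟨p₁, hx.1⟩
      exact Prod.ext (h5.left_unique hx.1) rfl
    · rintro ⟨r, q'⟩ hx
      simp only [Finset.mem_filter, mem_factorizations] at hx
      have h5 : IsComp r (Classical.epsilon fun q' => IsComp r q' q) q :=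
        Classical.epsilon_spec (p := fun q' => IsComp r q' q) ⟨q', hx.1⟩
      exact Prod.ext rfl (h5.right_unique hx.1)
    · intro x _
      rfl

end Criterion

/-! ### Morphisms of quivers and paths -/

section MapPaths

variable {V : Type v} [Quiver.{w} V] {V' : Type x} [Quiver.{y} V']

/-- The image of a path under a morphism of quivers. -/
def AllPaths.map (F : V ⥤q V') (p : AllPaths V) : AllPaths V' :=
  ⟨F.obj p.1, F.obj p.2.1, F.mapPath p.2.2⟩

@[simp]
theorem AllPaths.length_map (F : V ⥤q V') (p : AllPaths V) : (p.map F).length = p.length :=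
  length_mapPath F p.2.2

theorem IsComp.map (F : V ⥤q V') {q r p : AllPaths V} (h : IsComp q r p) :
    IsComp (q.map F) (r.map F) (p.map F) := by
  obtain ⟨q, r⟩ := h
  rw [AllPaths.map, AllPaths.map, AllPaths.map, Prefunctor.mapPath_comp]
  exact .intro _ _

theorem AllPaths.map_injective (F : V ⥤q V') (hobj : Function.Injective F.obj)
    (hmap : ∀ a b : V, Function.Injective (F.map : (a ⟶ b) → (F.obj a ⟶ F.obj b))) :
    Function.Injective (AllPaths.map F) := by
  have key : ∀ {a b : V} (p p' : Quiver.Path a b), F.mapPath p = F.mapPath p' → p = p' := by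
    intro a b p
    induction p with
    | nil =>
      intro p' h
      refine (Quiver.Path.eq_nil_of_length_zero p' ?_).symm
      rw [← length_mapPath F, ← h]
      rfl
    | cons p e ih =>
      intro p' h
      cases p' with
      | nil => exact absurd h (Quiver.Path.cons_ne_nil _ _)
      | cons p' e' =>
        simp only [Prefunctor.mapPath_cons] at h
        have hb := hobj (Quiver.Path.obj_eq_of_cons_eq_cons h)
        subst hb
        rw [ih p' (eq_of_heq (Quiver.Path.heq_of_cons_eq_cons h)),
          hmap _ _ (eq_of_heq (Quiver.Path.hom_heq_of_cons_eq_cons h))]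
  rintro ⟨a, b, p⟩ ⟨a', b', p'⟩ h
  have ha : a = a' := hobj (congrArg Sigma.fst h)
  subst ha
  have hb : b = b' := hobj (congrArg (fun q : AllPaths V' => q.2.1) h)
  subst hb
  rw [AllPaths.map, AllPaths.map, Sigma.mk.injEq] at h
  have h2 := eq_of_heq h.2
  rw [Sigma.mk.injEq] at h2
  rw [key p p' (eq_of_heq h2.2)]

theorem PathCoalgebra.mapHom_injective (K : Type u) [Field K] (F : V ⥤q V')
    (hF : Function.Injective (AllPaths.map F)) :
    Function.Injective (PathCoalgebra.mapHom K F) :=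
  (basis K V).injective_constr_of_linearIndependent (R₂ := K)
    ((basis K V').linearIndependent.comp _ hF)

theorem IsQuiverIso.map_injective {F : V ⥤q V'} (hF : IsQuiverIso F) :
    Function.Injective (AllPaths.map F) :=
  AllPaths.map_injective F hF.bijective_obj.1 fun a b => (hF.bijective_map a b).1

theorem IsQuiverIso.map_surjective {F : V ⥤q V'} (hF : IsQuiverIso F) :
    Function.Surjective (AllPaths.map F) := by
  rintro ⟨a, b, p⟩
  obtain ⟨a, rfl⟩ := hF.bijective_obj.2 a
  induction p with
  | nil => exact ⟨.vertex a, rfl⟩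
  | @cons b c p e ih =>
    obtain ⟨⟨a', b', p'⟩, h⟩ := ih
    obtain ⟨c, rfl⟩ := hF.bijective_obj.2 c
    have ha : a' = a := hF.bijective_obj.1 (congrArg Sigma.fst h)
    subst ha
    obtain ⟨b, rfl⟩ := hF.bijective_obj.2 b
    have hb : b' = b := hF.bijective_obj.1 (congrArg (fun q : AllPaths V' => q.2.1) h)
    subst hb
    obtain ⟨e, rfl⟩ := (hF.bijective_map _ _).2 e
    refine ⟨⟨a', c, p'.cons e⟩, ?_⟩
    rw [AllPaths.map, Sigma.mk.injEq] at h
    have h2 := eq_of_heq h.2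
    rw [Sigma.mk.injEq] at h2
    rw [AllPaths.map, Prefunctor.mapPath_cons, eq_of_heq h2.2]

theorem Subquiver.map_incl_injective (H : Subquiver V) :
    Function.Injective (AllPaths.map H.incl) :=
  AllPaths.map_injective H.incl (fun _ _ h => Subtype.ext h) fun _ _ _ _ h => Subtype.ext h

end MapPaths

/-! ### Disjoint unions of subquivers and direct sums of coalgebras -/

section DirectSum

variable {K : Type u} {V : Type v} [Field K] [Quiver.{w} V]
  {C : Subcoalgebra K (PathCoalgebra K V)}

/-- A path of `C` is contained in every part of the disjoint union which contains its source. -/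
theorem Subquiver.IsDisjointUnion.exists_map_eq {ι : Type x} {H : ι → Subquiver V}
    (hH : C.subquiver.IsDisjointUnion H) (i : ι) (p : AllPaths V) (hp : p ∈ C.paths)
    (hi : p.1 ∈ (H i).verts) : ∃ p' : AllPaths (H i).Vert, p'.map (H i).incl = p := by
  obtain ⟨a, b, p⟩ := p
  induction p with
  | nil => exact ⟨.vertex ⟨a, hi⟩, rfl⟩
  | @cons b c p e ih =>
    obtain ⟨hp1, hp2⟩ := factors_mem C p e.toPath hp
    obtain ⟨⟨a', b', p'⟩, h⟩ := ih hp1 hi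
    cases h
    have he : e ∈ C.subquiver.arrows _ _ := hp2
    rw [hH.arrows_eq, Set.mem_iUnion] at he
    obtain ⟨j, hj⟩ := he
    obtain rfl : i = j := by
      by_contra hij
      exact Set.disjoint_left.1 (hH.disjoint i j hij) b'.2 ((H j).src_mem hj)
    exact ⟨⟨a', ⟨c, (H i).tgt_mem hj⟩, p'.cons ⟨e, hj⟩⟩, rfl⟩

theorem Subquiver.IsDisjointUnion.bijective_map_incl {ι : Type x} {H : ι → Subquiver V}
    (hH : C.subquiver.IsDisjointUnion H) :
    Function.Bijective fun p : Σ i, {p : AllPaths (H i).Vert | p.map (H i).incl ∈ C.paths} =>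
      (⟨p.2.1.map (H p.1).incl, p.2.2⟩ : C.paths) := by
  constructor
  · rintro ⟨i, p, hp⟩ ⟨j, q, hq⟩ h
    have h' : p.map (H i).incl = q.map (H j).incl := congrArg Subtype.val h
    obtain rfl : i = j := by
      by_contra hij
      refine Set.disjoint_left.1 (hH.disjoint i j hij) p.1.2 ?_
      have h1 : p.1.1 = q.1.1 := congrArg Sigma.fst h'
      rw [h1]
      exact q.1.2
    cases (H i).map_incl_injective h'
    rfl
  · rintro ⟨p, hp⟩
    have hsrc : p.1 ∈ C.subquiver.verts := by
      have hp' : ofPath K (Quiver.Path.nil.comp p.2.2) ∈ C.toSubmodule := by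
        rwa [Quiver.Path.nil_comp]
      exact (factors_mem C _ _ hp').1
    rw [hH.verts_eq, Set.mem_iUnion] at hsrc
    obtain ⟨i, hi⟩ := hsrc
    obtain ⟨p', rfl⟩ := hH.exists_map_eq i p hp hi
    exact ⟨⟨i, p', hp⟩, rfl⟩

theorem DFinsupp.basis_apply {ι : Type*} [DecidableEq ι] {R : Type*} {M : ι → Type*} [Semiring R]
    [∀ i, AddCommMonoid (M i)] [∀ i, Module R (M i)] {η : ι → Type*}
    (b : ∀ i, Module.Basis (η i) R (M i)) (i : ι) (j : η i) :
    DFinsupp.basis b ⟨i, j⟩ = DFinsupp.single i (b i j) := by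
  classical
  refine (DFinsupp.basis b).repr.injective ?_
  rw [Module.Basis.repr_self]
  change _ = (sigmaFinsuppLequivDFinsupp R).symm
    (DFinsupp.mapRange.linearEquiv (fun i => (b i).repr) (DFinsupp.single i (b i j)))
  rw [LinearEquiv.eq_symm_apply]
  simp [DFinsupp.mapRange_single]

/-- If `C ∩ Γ` is a disjoint union of subquivers, then `C` is the direct sum of the components,
because the paths of `C` are the paths of the components. -/
theorem exists_directSum_equiv (hC : IsPathSubcoalgebra C) {ι : Type x} [DecidableEq ι]
    {H : ι → Subquiver V} (hH : C.subquiver.IsDisjointUnion H) :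
    ∃ Φ : (Π₀ i, (C.component (H i)).toSubmodule) ≃ₗc[K] C.toSubmodule,
      ∀ (i : ι) (c : (C.component (H i)).toSubmodule),
        (Φ (DFinsupp.single i c) : PathCoalgebra K V) = PathCoalgebra.map K (H i).incl c := by
  obtain ⟨S, hS, rfl⟩ := hC.eq_spanPaths
  let C := spanPaths K S hS
  have hCS : C.paths = S := Set.ext (mem_paths_spanPaths K hS)
  have hT : ∀ i, SubpathClosed {p : AllPaths (H i).Vert | p.map (H i).incl ∈ C.paths} := by
    intro i a b c q r h
    rw [hCS] at h ⊢
    have hc := (IsComp.intro q r).map (H i).incl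
    exact ⟨hS.left hc h, hS.right hc h⟩
  let bc (i : ι) : Module.Basis {p : AllPaths (H i).Vert | p.map (H i).incl ∈ C.paths} K
    (C.component (H i)).toSubmodule := spanPathsBasis K (hT i)
  have hbc : ∀ i p, (bc i p : PathCoalgebra K (H i).Vert) = basis K (H i).Vert p.1 := fun i p =>
    coe_spanPathsBasis K (hT i) p
  let b := DFinsupp.basis bc
  let e := (Equiv.ofBijective _ hH.bijective_map_incl).trans (Equiv.setCongr hCS)
  let E : (Π₀ i, (C.component (H i)).toSubmodule) ≃ₗ[K] C.toSubmodule :=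
    b.equiv (spanPathsBasis K hS) e
  have hE : ∀ i c, (E (DFinsupp.single i c) : PathCoalgebra K V) =
      PathCoalgebra.map K (H i).incl c := by
    intro i
    suffices h : C.toSubmodule.subtype ∘ₗ E.toLinearMap ∘ₗ DFinsupp.lsingle i =
        PathCoalgebra.map K (H i).incl ∘ₗ (C.component (H i)).toSubmodule.subtype from
      fun c => LinearMap.congr_fun h c
    refine (bc i).ext fun p => ?_
    change (E (DFinsupp.single i (bc i p)) : PathCoalgebra K V) =
      PathCoalgebra.map K (H i).incl (bc i p : PathCoalgebra K (H i).Vert)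
    rw [← DFinsupp.basis_apply, hbc]
    refine (congrArg Subtype.val (b.equiv_apply _ _ _)).trans ?_
    rw [coe_spanPathsBasis]
    exact (map_ofPath K (H i).incl p.1.2.2).symm
  have hmem : ∀ i c, ((PathCoalgebra.mapHom K (H i).incl).comp
      (C.component (H i)).subtypeHom) c ∈ C.toSubmodule := by
    intro i c
    have h := (E (DFinsupp.single i c)).2
    rw [hE] at h
    exact h
  let F := DFinsupp.coalgHomOfSingle E.toLinearMap
    (fun i => C.codRestrictHom _ (hmem i)) fun i c => Subtype.ext (hE i c)
  exact ⟨CoalgEquiv.ofBijective (f := F) E.bijective, hE⟩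

end DirectSum

/-! ### The model coalgebras are left co-Frobenius -/

/-- A quiver with exactly one arrow `a ⟶ succ a` for every vertex `a`, and no other arrows, where
`succ` is injective. The quivers `A_∞`, `A_{0,∞}` and `C_n` with `n ≥ 1` are of this kind. -/
structure IsSuccQuiver (M : Type v) [Quiver.{w} M] (succ : M → M) : Prop where
  injective : Function.Injective succ
  subsingleton : ∀ a b : M, Subsingleton (a ⟶ b)
  nonempty_hom_iff : ∀ a b : M, Nonempty (a ⟶ b) ↔ b = succ a

namespace IsSuccQuiver

variable {M : Type v} [Quiver.{w} M] {succ : M → M}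

theorem tgt_eq (hM : IsSuccQuiver M succ) (p : AllPaths M) :
    p.2.1 = succ^[p.length] p.1 := by
  obtain ⟨a, b, p⟩ := p
  induction p with
  | nil => rfl
  | cons p e ih =>
    refine ((hM.nonempty_hom_iff _ _).1 ⟨e⟩).trans ?_
    exact (congrArg succ ih).trans (Function.iterate_succ_apply' succ _ _).symm

theorem exists_path (hM : IsSuccQuiver M succ) (a : M) (n : ℕ) :
    ∃ p : AllPaths M, p.1 = a ∧ p.length = n := by
  induction n with
  | zero => exact ⟨.vertex a, rfl, rfl⟩
  | succ n ih =>
    obtain ⟨⟨a, b, p⟩, rfl, rfl⟩ := ih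
    obtain ⟨e⟩ := (hM.nonempty_hom_iff b (succ b)).2 rfl
    exact ⟨⟨a, succ b, p.cons e⟩, rfl, rfl⟩

theorem path_unique (hM : IsSuccQuiver M succ) {p q : AllPaths M} (h : p.1 = q.1)
    (hl : p.length = q.length) : p = q := by
  obtain ⟨a, b, p⟩ := p
  obtain ⟨a', b', q⟩ := q
  obtain rfl : a = a' := h
  obtain rfl : b = b' := by
    have h1 := hM.tgt_eq ⟨a, b, p⟩
    rw [hl] at h1
    exact h1.trans (hM.tgt_eq ⟨a, b', q⟩).symm
  have key : ∀ {b : M} (p q : Quiver.Path a b), p.length = q.length → p = q := by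
    intro b p
    induction p with
    | nil => exact fun q hl => (Quiver.Path.eq_nil_of_length_zero q hl.symm).symm
    | @cons c d p e ih =>
      intro q hl
      cases q with
      | nil => simp at hl
      | @cons c' _ q e' =>
        have hc : c = c' := hM.injective <|
          ((hM.nonempty_hom_iff _ _).1 ⟨e⟩).symm.trans ((hM.nonempty_hom_iff _ _).1 ⟨e'⟩)
        subst hc
        rw [ih q (by simpa using hl), (hM.subsingleton _ _).elim e e']
  rw [key p q hl]

/-- If the set `S` consists of the paths of length at most `ℓ a` with source `a`, where `ℓ` does not
decrease along arrows, then the path of length `ℓ a` starting at `a` is dominating. -/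
theorem hasDominatingPaths (hM : IsSuccQuiver M succ) {S : Set (AllPaths M)} (ℓ : M → ℕ)
    (hS : ∀ p, p ∈ S ↔ p.length ≤ ℓ p.1) (hℓ : ∀ a, ℓ a ≤ ℓ (succ a)) :
    HasDominatingPaths S := by
  have hℓ' : ∀ a n, ℓ a ≤ ℓ (succ^[n] a) := by
    intro a n
    induction n with
    | zero => exact le_rfl
    | succ n ih =>
      rw [Function.iterate_succ_apply']
      exact ih.trans (hℓ _)
  intro a _
  obtain ⟨Q, rfl, hQ⟩ := hM.exists_path a (ℓ a)
  refine ⟨Q, (hS Q).2 hQ.le, rfl, fun p hp hpa => ?_, fun p hp hpt => ?_⟩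
  · have hl := (hS p).1 hp
    rw [hpa] at hl
    obtain ⟨x, hx, hxl⟩ := hM.exists_path p.2.1 (Q.length - p.length)
    obtain ⟨t, ht⟩ := IsComp.exists_comp hx
    have h := ht.length_eq
    rw [← hM.path_unique (ht.src_eq.symm.trans hpa) (show t.length = Q.length by omega)]
    exact ⟨x, ht⟩
  · have hl := (hS p).1 hp
    rw [hM.tgt_eq p, hM.tgt_eq Q] at hpt
    by_cases hle : p.length ≤ Q.length
    · obtain ⟨x, hx, hxl⟩ := hM.exists_path Q.1 (Q.length - p.length)
      have hxp : p.1 = x.2.1 := by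
        rw [hM.tgt_eq x, hx, hxl]
        refine hM.injective.iterate p.length ?_
        rw [← Function.iterate_add_apply, Nat.add_sub_cancel' hle, hpt]
      obtain ⟨t, ht⟩ := IsComp.exists_comp hxp
      have h := ht.length_eq
      rw [← hM.path_unique (ht.src_eq.symm.trans hx) (show t.length = Q.length by omega)]
      exact ⟨x, ht⟩
    · -- A longer path `p` would pass through the source of `Q`, where `ℓ` is too small.
      have h1 : succ^[p.length - Q.length] p.1 = Q.1 := by
        refine hM.injective.iterate Q.length ?_
        rw [← Function.iterate_add_apply, Nat.add_sub_cancel' (by omega), hpt]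
      have h2 := hℓ' p.1 (p.length - Q.length)
      rw [h1] at h2
      omega

end IsSuccQuiver

theorem LineQuiver.isSuccQuiver : IsSuccQuiver LineQuiver fun a => ⟨a.idx + 1⟩ where
  injective := by
    rintro ⟨a⟩ ⟨b⟩ h
    simpa using h
  subsingleton _ _ := inferInstanceAs (Subsingleton (PLift _))
  nonempty_hom_iff := by
    rintro ⟨a⟩ ⟨b⟩
    simp [Quiver.Hom]

theorem RayQuiver.isSuccQuiver : IsSuccQuiver RayQuiver fun a => ⟨a.idx + 1⟩ where
  injective := by
    rintro ⟨a⟩ ⟨b⟩ h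
    simpa using h
  subsingleton _ _ := inferInstanceAs (Subsingleton (PLift _))
  nonempty_hom_iff := by
    rintro ⟨a⟩ ⟨b⟩
    simp [Quiver.Hom]

theorem CycleQuiver.isSuccQuiver (n : ℕ) : IsSuccQuiver (CycleQuiver n) fun a => ⟨a.idx + 1⟩ where
  injective := by
    rintro ⟨a⟩ ⟨b⟩ h
    simpa using h
  subsingleton _ _ := inferInstanceAs (Subsingleton (PLift _))
  nonempty_hom_iff := by
    rintro ⟨a⟩ ⟨b⟩
    simp [Quiver.Hom]

theorem ModelType.isLeftCoFrobenius (K : Type u) [Field K] (t : ModelType) :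
    IsLeftCoFrobenius K (t.coalgebra K).toSubmodule := by
  cases t with
  | line r hr hlt =>
    change IsLeftCoFrobenius K (lineCoalgebra K r hr).toSubmodule
    unfold lineCoalgebra
    refine isLeftCoFrobenius_of_hasDominatingPaths _
      (LineQuiver.isSuccQuiver.hasDominatingPaths (fun a => (r a.idx - a.idx).toNat) ?_ ?_)
    · intro p
      have := hlt p.1.idx
      change (p.length : ℤ) ≤ _ ↔ _
      omega
    · intro a
      have := hr (lt_add_one a.idx)
      have := hlt a.idx
      change (r a.idx - a.idx).toNat ≤ (r (a.idx + 1) - (a.idx + 1)).toNat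
      omega
  | ray r hr hpos =>
    change IsLeftCoFrobenius K (rayCoalgebra K r hr).toSubmodule
    unfold rayCoalgebra
    refine isLeftCoFrobenius_of_hasDominatingPaths _
      (RayQuiver.isSuccQuiver.hasDominatingPaths (fun a => r a.idx - a.idx) ?_ ?_)
    · intro p
      have := hr.le_apply (x := p.1.idx)
      change p.1.idx + p.length ≤ _ ↔ _
      omega
    · intro a
      have := hr (lt_add_one a.idx)
      change r a.idx - a.idx ≤ r (a.idx + 1) - (a.idx + 1)
      omega
  | cycle n s hn hs =>
    change IsLeftCoFrobenius K (cycleCoalgebra K n s).toSubmodule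
    unfold cycleCoalgebra
    exact isLeftCoFrobenius_of_hasDominatingPaths _
      ((CycleQuiver.isSuccQuiver n).hasDominatingPaths (fun _ => s) (fun _ => Iff.rfl)
        fun _ => le_rfl)
  | point =>
    change IsLeftCoFrobenius K (pointCoalgebra K).toSubmodule
    unfold pointCoalgebra
    have h : ∀ p : AllPaths PointQuiver, p = .vertex .pt := by
      rintro ⟨⟨⟩, b, p⟩
      cases p with
      | nil => rfl
      | cons _ e => exact e.elim
    refine isLeftCoFrobenius_of_hasDominatingPaths _ fun a _ =>
      ⟨.vertex a, trivial, rfl, fun p _ _ => ⟨.vertex a, ?_⟩, fun p _ _ => ⟨.vertex a, ?_⟩⟩ <;>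
    · rw [h p]
      exact .intro _ _

section OfDecomposition

variable {K : Type u} {V : Type v} [Field K] [Quiver.{w} V]
  {C : Subcoalgebra K (PathCoalgebra K V)}

theorem IsDecomposition.nonempty_equiv (hC : IsPathSubcoalgebra C) {ι : Type x} [DecidableEq ι]
    {H : ι → Subquiver V} {t : ι → ModelType} (h : IsDecomposition C H t) :
    Nonempty (C.toSubmodule ≃ₗc[K] Π₀ i, ((t i).coalgebra K).toSubmodule) := by
  obtain ⟨Φ, -⟩ := exists_directSum_equiv hC h.disjointUnion
  obtain ⟨Ψ⟩ := nonempty_dfinsupp_equiv fun i => (h.coalgebra_type i).some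
  exact ⟨Φ.symm.trans Ψ⟩

theorem IsDecomposition.isLeftCoFrobenius (hC : IsPathSubcoalgebra C) {ι : Type x}
    {H : ι → Subquiver V} {t : ι → ModelType} (h : IsDecomposition C H t) :
    IsLeftCoFrobenius K C.toSubmodule := by
  classical
  obtain ⟨e⟩ := h.nonempty_equiv hC
  exact .of_equiv e (.dfinsupp fun i => (t i).isLeftCoFrobenius K)

end OfDecomposition

/-! ### Orbits of injective maps -/

section Orbits

variable {α : Type*} {f : α → α}

/-- Two points are in the same orbit of a self-map if some iterates of them agree. -/
def orbitSetoid (f : α → α) : Setoid α where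
  r a b := ∃ m n, f^[m] a = f^[n] b
  iseqv :=
    { refl := fun _ => ⟨0, 0, rfl⟩
      symm := fun ⟨m, n, h⟩ => ⟨n, m, h.symm⟩
      trans := by
        rintro a b c ⟨m, n, h⟩ ⟨m', n', h'⟩
        refine ⟨m' + m, n + n', ?_⟩
        rw [Function.iterate_add_apply, h, ← Function.iterate_add_apply, Nat.add_comm,
          Function.iterate_add_apply, h', ← Function.iterate_add_apply] }

/-- An injective parametrization of the orbit of `a`, with `f` corresponding to `k ↦ k + 1`. -/
structure IsOrbitParam (f : α → α) (a : α) {I : Type*} [Add I] [One I] (u : I → α) : Prop where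
  injective : Function.Injective u
  map_add_one : ∀ k, u (k + 1) = f (u k)
  mem_range_iff : ∀ b, b ∈ Set.range u ↔ orbitSetoid f b a

/-- An orbit with an element `b` outside of the range of `f` consists of the iterates of `b`. -/
theorem exists_param_nat (hf : Function.Injective f) {a b : α} (hab : orbitSetoid f b a)
    (hb : b ∉ Set.range f) : ∃ u : ℕ → α, IsOrbitParam f a u := by
  have hne : ∀ k c, f^[k + 1] c ≠ b := fun k c h =>
    hb ⟨f^[k] c, by rw [← Function.iterate_succ_apply' f, h]⟩
  refine ⟨fun n => f^[n] b, fun m n h => ?_, fun k => Function.iterate_succ_apply' f k b,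
    fun c => ⟨?_, fun hc => ?_⟩⟩
  · wlog hmn : m ≤ n generalizing m n
    · exact (this n m h.symm (by omega)).symm
    obtain ⟨k, rfl⟩ := Nat.exists_eq_add_of_le hmn
    simp only [Function.iterate_add_apply] at h
    cases k with
    | zero => rfl
    | succ k => exact absurd (hf.iterate m h).symm (hne k b)
  · rintro ⟨n, rfl⟩
    exact Setoid.trans' _ ⟨0, n, rfl⟩ hab
  · obtain ⟨m, n, h⟩ := Setoid.trans' _ hc (Setoid.symm' _ hab)
    by_cases hmn : m ≤ n
    · obtain ⟨k, rfl⟩ := Nat.exists_eq_add_of_le hmn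
      rw [Function.iterate_add_apply] at h
      exact ⟨k, (hf.iterate m h).symm⟩
    · obtain ⟨k, rfl⟩ := Nat.exists_eq_add_of_lt (not_le.1 hmn)
      rw [Nat.add_assoc, Function.iterate_add_apply] at h
      exact absurd (hf.iterate n h) (hne k c)

/-- The orbit of a periodic point is parametrized by the integers modulo its minimal period. -/
theorem exists_param_zmod (hf : Function.Injective f) {a : α} {k : ℕ} (hk : 0 < k)
    (ha : f^[k] a = a) : ∃ n, 1 ≤ n ∧ ∃ u : ZMod n → α, IsOrbitParam f a u := by
  let n := Function.minimalPeriod f a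
  have hn : 0 < n := Function.minimalPeriod_pos_of_mem_periodicPts ⟨k, hk, ha⟩
  have : NeZero n := ⟨hn.ne'⟩
  have hmod : ∀ j, f^[j % n] a = f^[j] a := fun j => Function.iterate_mod_minimalPeriod_eq
  refine ⟨n, hn, fun i => f^[i.val] a, fun i j h => ?_, fun i => ?_, fun b => ⟨?_, ?_⟩⟩
  · exact ZMod.val_injective n (Function.iterate_injOn_Iio_minimalPeriod (ZMod.val_lt i)
      (ZMod.val_lt j) h)
  · rw [ZMod.val_add, ZMod.val_one_eq_one_mod, Nat.add_mod_mod, hmod,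
      Function.iterate_succ_apply']
  · rintro ⟨i, rfl⟩
    exact ⟨0, i.val, rfl⟩
  · rintro ⟨m, l, h⟩
    -- `b = f^[l - m] a`, and `l - m` can be replaced by `l + (n - 1) m ≥ 0`.
    refine ⟨((l + (n - 1) * m : ℕ) : ZMod n), ?_⟩
    change f^[ZMod.val ((l + (n - 1) * m : ℕ) : ZMod n)] a = b
    rw [ZMod.val_natCast, hmod]
    refine hf.iterate m ?_
    have hlm : m + (l + (n - 1) * m) = l + n * m := by
      obtain ⟨n', hn'⟩ := Nat.exists_eq_add_of_lt hn
      rw [hn']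
      simp only [Nat.zero_add, Nat.add_sub_cancel]
      ring
    rw [h, ← Function.iterate_add_apply, hlm, ← hmod, Nat.add_mul_mod_self_left, hmod]

/-- An orbit contained in the range of `f` is permuted by `f`; if `a` is not periodic, the orbit
is parametrized by the integer powers of this permutation. -/
theorem exists_param_int (hf : Function.Injective f) {a : α}
    (hsurj : ∀ b, orbitSetoid f b a → b ∈ Set.range f) (ha : ∀ k, 0 < k → f^[k] a ≠ a) :
    ∃ u : ℤ → α, IsOrbitParam f a u := by
  let X := {b // orbitSetoid f b a}
  have hfX : ∀ b, orbitSetoid f b a ↔ orbitSetoid f (f b) a := fun b =>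
    ⟨Setoid.trans' _ ⟨0, 1, rfl⟩, Setoid.trans' _ ⟨1, 0, rfl⟩⟩
  let e : Equiv.Perm X := Equiv.ofBijective (fun b => ⟨f b.1, (hfX _).1 b.2⟩)
    ⟨fun b c h => Subtype.ext (hf (congrArg Subtype.val h)), fun ⟨b, hb⟩ => by
      obtain ⟨c, rfl⟩ := hsurj b hb
      exact ⟨⟨c, (hfX c).2 hb⟩, rfl⟩⟩
  have he : ∀ (k : ℕ) (b : X), ((e ^ k) b).1 = f^[k] b.1 := by
    intro k b
    induction k with
    | zero => rfl
    | succ k ih => rw [pow_succ', Equiv.Perm.mul_apply, Function.iterate_succ_apply', ← ih]; rfl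
  let a' : X := ⟨a, Setoid.refl' _ a⟩
  have hper : ∀ z : ℤ, (e ^ z) a' = a' → z = 0 := by
    have hnat : ∀ k : ℕ, (e ^ k) a' = a' → k = 0 := by
      intro k hk
      by_contra h0
      exact ha k (Nat.pos_of_ne_zero h0) ((he k a').symm.trans (congrArg Subtype.val hk))
    intro z hz
    obtain ⟨k, rfl | rfl⟩ := z.eq_nat_or_neg
    · rw [zpow_natCast] at hz
      simp [hnat k hz]
    · rw [zpow_neg, zpow_natCast, Equiv.Perm.inv_eq_iff_eq] at hz
      simp [hnat k hz.symm]
  refine ⟨fun z => ((e ^ z) a').1, fun y z h => ?_, fun z => ?_, fun b => ⟨?_, fun hb => ?_⟩⟩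
  · have h' : (e ^ y) a' = (e ^ z) a' := Subtype.ext h
    have h1 : (e ^ (-z + y)) a' = a' := by
      rw [zpow_add, Equiv.Perm.mul_apply, h', ← Equiv.Perm.mul_apply, ← zpow_add, neg_add_cancel,
        zpow_zero, Equiv.Perm.one_apply]
    have := hper _ h1
    omega
  · change ((e ^ (z + 1)) a').1 = f ((e ^ z) a').1
    rw [add_comm, zpow_add, zpow_one]
    rfl
  · rintro ⟨z, rfl⟩
    exact ((e ^ z) a').2
  · obtain ⟨m, n, h⟩ := id hb
    refine ⟨-m + n, ?_⟩
    have h1 : (e ^ m) ⟨b, hb⟩ = (e ^ n) a' := Subtype.ext (by rw [he, he]; exact h)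
    change ((e ^ (-m + n : ℤ)) a').1 = b
    rw [zpow_add, Equiv.Perm.mul_apply, zpow_natCast, ← h1, zpow_neg, zpow_natCast,
      ← Equiv.Perm.mul_apply, inv_mul_cancel, Equiv.Perm.one_apply]

end Orbits

/-! ### Quivers with dominating paths -/

section Dominating

variable {V : Type v} [Quiver.{w} V] {S : Set (AllPaths V)}

theorem IsDominating.exists_prefix {a : V} {Q p p' : AllPaths V} (hQ : IsDominating S a Q)
    (hp : p ∈ S) (hp' : p' ∈ S) (ha : p.1 = a) (ha' : p'.1 = a) (hl : p.length ≤ p'.length) :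
    ∃ y, IsComp p y p' := by
  obtain ⟨x, hx⟩ := hQ.prefix_of_src p hp ha
  obtain ⟨x', hx'⟩ := hQ.prefix_of_src p' hp' ha'
  exact hx.exists_prefix hx' hl

/-- The paths of positive length have a first arrow. -/
theorem AllPaths.exists_arrow_comp (p : AllPaths V) (hp : 1 ≤ p.length) :
    ∃ e x, IsComp e x p ∧ e.length = 1 := by
  obtain ⟨a, b, p⟩ := p
  obtain ⟨n, hn⟩ := Nat.exists_eq_add_of_le hp
  obtain ⟨c, e, q, h1, h2⟩ := Quiver.Path.eq_toPath_comp_of_length_eq_succ p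
    (n := n) (hn.trans (Nat.add_comm 1 n))
  exact ⟨⟨a, c, e.toPath⟩, ⟨c, b, q⟩, by rw [h2]; exact .intro _ _, rfl⟩

namespace PathCoalgebra.SubpathClosed

theorem src_mem (hS : SubpathClosed S) {p : AllPaths V} (hp : p ∈ S) : AllPaths.vertex p.1 ∈ S :=
  hS.left (IsComp.vertex_left p) hp

theorem tgt_mem (hS : SubpathClosed S) {p : AllPaths V} (hp : p ∈ S) : AllPaths.vertex p.2.1 ∈ S :=
  hS.right (IsComp.vertex_right p) hp

theorem eq_of_src_eq (hS : SubpathClosed S) (h : HasDominatingPaths S)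
    {p p' : AllPaths V} (hp : p ∈ S) (hp' : p' ∈ S) (ha : p.1 = p'.1)
    (hl : p.length = p'.length) : p = p' := by
  obtain ⟨Q, hQ⟩ := h p.1 (hS.src_mem hp)
  obtain ⟨y, hy⟩ := hQ.exists_prefix hp hp' rfl ha.symm hl.le
  exact hy.eq_of_prefix_of_length_eq hl

/-- A vertex has at most one incoming arrow: the dominating paths `e q` and `e' q'` which start
with two such arrows have comparable tails `q` and `q'`. If `q` is a prefix of `q'`, then `e' q` is
a suffix of `e q`, so that `e = e'`. -/
theorem eq_of_tgt_eq (hS : SubpathClosed S) (h : HasDominatingPaths S)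
    {e e' : AllPaths V} (he : e ∈ S) (he' : e' ∈ S) (ht : e.2.1 = e'.2.1)
    (hl : e.length = 1) (hl' : e'.length = 1) : e = e' := by
  obtain ⟨Q, hQ⟩ := h e.1 (hS.src_mem he)
  obtain ⟨Q', hQ'⟩ := h e'.1 (hS.src_mem he')
  obtain ⟨q, hq⟩ := hQ.prefix_of_src e he rfl
  obtain ⟨q', hq'⟩ := hQ'.prefix_of_src e' he' rfl
  wlog hqq : q.length ≤ q'.length generalizing e e' Q Q' q q'
  · exact (this he' he ht.symm hl' hl Q' hQ' Q hQ q' hq' q hq (by omega)).symm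
  obtain ⟨R, hR⟩ := h e.2.1 (hS.tgt_mem he)
  obtain ⟨x, hx⟩ := hR.exists_prefix (hS.right hq hQ.mem) (hS.right hq' hQ'.mem) hq.mid_eq
    (hq'.mid_eq.trans ht.symm) hqq
  obtain ⟨t, ht1, ht2⟩ := hq'.assoc' hx
  have htS : t ∈ S := hS.left ht2 hQ'.mem
  obtain ⟨y, hy⟩ := hQ.suffix_of_tgt t htS (ht1.tgt_eq.symm.trans hq.tgt_eq)
  have h1 := ht1.length_eq
  have h2 := hq.length_eq
  have h3 := hy.eq_of_suffix_of_length_eq (by omega)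
  rw [h3] at ht1
  exact (ht1.left_unique hq).symm

/-- A vertex with an incoming arrow has an outgoing arrow, since otherwise the dominating path at
this vertex is trivial and the incoming arrow is not a suffix of it. -/
theorem exists_arrow_of_tgt (hS : SubpathClosed S) (h : HasDominatingPaths S)
    {e : AllPaths V} (he : e ∈ S) (hl : e.length = 1) :
    ∃ e' ∈ S, e'.1 = e.2.1 ∧ e'.length = 1 := by
  obtain ⟨Q, hQ⟩ := h e.2.1 (hS.tgt_mem he)
  by_cases h0 : 1 ≤ Q.length
  · obtain ⟨e', x, hx, hl'⟩ := Q.exists_arrow_comp h0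
    exact ⟨e', hS.left hx hQ.mem, hx.src_eq.trans hQ.src, hl'⟩
  · have h1 := AllPaths.eq_vertex_of_length (p := Q) (by omega)
    obtain ⟨y, hy⟩ := hQ.suffix_of_tgt e he (by rw [h1]; exact hQ.src.symm)
    have := hy.length_eq
    omega

/-- Along an arrow `e : a ⟶ b`, the length of the dominating path does not decrease: otherwise
`Q a = e (Q b)`, so that `Q a` is a path with the same end as `Q b` and longer than `Q b`. -/
theorem length_le_length (hS : SubpathClosed S) {e Q R : AllPaths V} (he : e ∈ S)
    (hl : e.length = 1) (hQ : IsDominating S e.1 Q) (hR : IsDominating S e.2.1 R) :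
    Q.length ≤ R.length := by
  by_contra! hlt
  obtain ⟨q, hq⟩ := hQ.prefix_of_src e he rfl
  have hqS := hS.right hq hQ.mem
  obtain ⟨x, hx⟩ := hR.prefix_of_src q hqS hq.mid_eq
  have h1 := hq.length_eq
  have h2 := hx.length_eq
  have h3 := hx.eq_of_prefix_of_length_eq (by omega)
  obtain ⟨y, hy⟩ := hR.suffix_of_tgt Q hQ.mem (by rw [← h3, hq.tgt_eq])
  have := hy.length_eq
  omega

/-- A path of `S` followed by an arrow of `S` belongs to `S` as soon as it is not longer than the
dominating path. -/
theorem comp_mem (hS : SubpathClosed S) (h : HasDominatingPaths S)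
    {a : V} {Q q e t : AllPaths V} (hQ : IsDominating S a Q) (hq : q ∈ S)
    (ha : q.1 = a) (he : e ∈ S) (hl : e.length = 1) (ht : IsComp q e t)
    (htQ : t.length ≤ Q.length) : t ∈ S := by
  obtain ⟨x, hx⟩ := hQ.prefix_of_src q hq ha
  have h1 := hx.length_eq
  have h2 := ht.length_eq
  obtain ⟨e', x', hx', hl'⟩ := x.exists_arrow_comp (by omega)
  have he' : e' ∈ S := hS.left hx' (hS.right hx hQ.mem)
  obtain rfl := hS.eq_of_src_eq h he he'
    (by rw [ht.mid_eq, hx'.src_eq, hx.mid_eq]) (hl.trans hl'.symm)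
  obtain ⟨t', h3, h4⟩ := hx.assoc' hx'
  rw [ht.comp_unique h3]
  exact hS.left h4 hQ.mem

end PathCoalgebra.SubpathClosed

end Dominating

/-! ### The decomposition into model quivers -/

section Decomposition

variable {V : Type v} [Quiver.{w} V] {S : Set (AllPaths V)}

theorem AllPaths.eq_toPath_of_length (p : AllPaths V) (hp : p.length = 1) :
    ∃ e : p.1 ⟶ p.2.1, p = ⟨p.1, p.2.1, e.toPath⟩ := by
  obtain ⟨a, b, p⟩ := p
  obtain ⟨c, e, q, h1, rfl⟩ := Quiver.Path.eq_toPath_comp_of_length_eq_succ p (n := 0) hp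
  obtain rfl := Quiver.Path.eq_of_length_zero q h1
  rw [Quiver.Path.eq_nil_of_length_zero q h1]
  exact ⟨e, rfl⟩

open Classical in
/-- The target of an arrow of `S` which starts at the given vertex of `S`, or the vertex itself if
there is no such arrow. -/
noncomputable def nextVertex (hS : SubpathClosed S) (a : {a : V // AllPaths.vertex a ∈ S}) :
    {a : V // AllPaths.vertex a ∈ S} :=
  if h : ∃ e ∈ S, e.1 = a.1 ∧ e.length = 1 then ⟨h.choose.2.1, hS.tgt_mem h.choose_spec.1⟩ else a

theorem nextVertex_of_forall (hS : SubpathClosed S) {a : {a : V // AllPaths.vertex a ∈ S}}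
    (ha : ¬∃ e ∈ S, e.1 = a.1 ∧ e.length = 1) : nextVertex hS a = a := dif_neg ha

theorem nextVertex_src (hS : SubpathClosed S) (h : HasDominatingPaths S) {e : AllPaths V}
    (he : e ∈ S) (hl : e.length = 1) :
    nextVertex hS ⟨e.1, hS.src_mem he⟩ = ⟨e.2.1, hS.tgt_mem he⟩ := by
  have hex : ∃ e' ∈ S, e'.1 = e.1 ∧ e'.length = 1 := ⟨e, he, rfl, hl⟩
  rw [nextVertex, dif_pos hex]
  have := hS.eq_of_src_eq h hex.choose_spec.1 he hex.choose_spec.2.1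
    (hex.choose_spec.2.2.trans hl.symm)
  exact Subtype.ext (congrArg (fun q : AllPaths V => q.2.1) this)

theorem exists_arrow_nextVertex (hS : SubpathClosed S) {a : {a : V // AllPaths.vertex a ∈ S}}
    (ha : ∃ e ∈ S, e.1 = a.1 ∧ e.length = 1) :
    ∃ e ∈ S, e.1 = a.1 ∧ e.2.1 = (nextVertex hS a).1 ∧ e.length = 1 := by
  rw [nextVertex, dif_pos ha]
  exact ⟨_, ha.choose_spec.1, ha.choose_spec.2.1, rfl, ha.choose_spec.2.2⟩

theorem nextVertex_injective (hS : SubpathClosed S) (h : HasDominatingPaths S) :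
    Function.Injective (nextVertex hS) := by
  intro a b hab
  by_cases ha : ∃ e ∈ S, e.1 = a.1 ∧ e.length = 1
  · obtain ⟨e, he, hea, het, hl⟩ := exists_arrow_nextVertex hS ha
    by_cases hb : ∃ e ∈ S, e.1 = b.1 ∧ e.length = 1
    · obtain ⟨e', he', heb, het', hl'⟩ := exists_arrow_nextVertex hS hb
      have := hS.eq_of_tgt_eq h he he' (by rw [het, het', hab]) hl hl'
      exact Subtype.ext (by rw [← hea, ← heb, this])
    · rw [nextVertex_of_forall hS hb] at hab
      obtain ⟨e', he', hs, hl'⟩ := hS.exists_arrow_of_tgt h he hl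
      exact absurd ⟨e', he', by rw [hs, het, hab], hl'⟩ hb
  · rw [nextVertex_of_forall hS ha] at hab
    by_cases hb : ∃ e ∈ S, e.1 = b.1 ∧ e.length = 1
    · obtain ⟨e, he, heb, het, hl⟩ := exists_arrow_nextVertex hS hb
      obtain ⟨e', he', hs, hl'⟩ := hS.exists_arrow_of_tgt h he hl
      exact absurd ⟨e', he', by rw [hs, het, hab], hl'⟩ ha
    · rwa [nextVertex_of_forall hS hb] at hab

/-- The length of the dominating path at a vertex, which is the largest length of a path of `S`
starting there. -/
noncomputable def maxLength (h : HasDominatingPaths S) (a : {a : V // AllPaths.vertex a ∈ S}) : ℕ :=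
  (h a.1 a.2).choose.length

theorem length_le_maxLength (hS : SubpathClosed S) (h : HasDominatingPaths S) {p : AllPaths V}
    (hp : p ∈ S) : p.length ≤ maxLength h ⟨p.1, hS.src_mem hp⟩ := by
  obtain ⟨x, hx⟩ := (h p.1 (hS.src_mem hp)).choose_spec.prefix_of_src p hp rfl
  exact (Nat.le_add_right _ _).trans hx.length_eq.symm.le

theorem maxLength_le_nextVertex (hS : SubpathClosed S) (h : HasDominatingPaths S)
    (a : {a : V // AllPaths.vertex a ∈ S}) : maxLength h a ≤ maxLength h (nextVertex hS a) := by
  by_cases ha : ∃ e ∈ S, e.1 = a.1 ∧ e.length = 1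
  · obtain ⟨a, ha'⟩ := a
    obtain ⟨e, he, rfl, hl⟩ := ha
    rw [nextVertex_src hS h he hl]
    exact hS.length_le_length he hl (h _ (hS.src_mem he)).choose_spec
      (h _ (hS.tgt_mem he)).choose_spec
  · rw [nextVertex_of_forall hS ha]

/-- The subquiver of the vertices in an orbit of `nextVertex` and of the arrows of `S` between
them. -/
def orbitSubquiver (hS : SubpathClosed S) (h : HasDominatingPaths S)
    (i : Quotient (orbitSetoid (nextVertex hS))) : Subquiver V where
  verts := {a | ∃ ha : AllPaths.vertex a ∈ S, Quotient.mk _ ⟨a, ha⟩ = i}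
  arrows a b := {e | (⟨a, b, e.toPath⟩ : AllPaths V) ∈ S ∧
    ∃ ha : AllPaths.vertex a ∈ S, Quotient.mk _ ⟨a, ha⟩ = i}
  src_mem he := he.2
  tgt_mem {a b e} he := by
    obtain ⟨ha, hi⟩ := he.2
    refine ⟨hS.tgt_mem he.1, Eq.trans (Quotient.sound (s := orbitSetoid _) ⟨0, 1, ?_⟩) hi⟩
    exact (nextVertex_src hS h he.1 rfl).symm

/-- A path in an orbit belongs to `S` if and only if it is not longer than the dominating path at
its source. -/
theorem map_incl_mem_iff (hS : SubpathClosed S) (h : HasDominatingPaths S)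
    (i : Quotient (orbitSetoid (nextVertex hS))) (p : AllPaths (orbitSubquiver hS h i).Vert) :
    p.map (orbitSubquiver hS h i).incl ∈ S ↔ p.length ≤ maxLength h ⟨p.1.1, p.1.2.1⟩ := by
  constructor
  · intro hp
    have := length_le_maxLength hS h hp
    rwa [AllPaths.length_map] at this
  · obtain ⟨a, b, p⟩ := p
    induction p with
    | nil => exact fun _ => a.2.1
    | @cons b c p e ih =>
      intro hl
      have hl' : p.length + 1 ≤ maxLength h ⟨a.1, a.2.1⟩ := hl
      have hp := ih (Nat.le_of_succ_le hl')
      have hc := (IsComp.intro p e.toPath).map (orbitSubquiver hS h i).incl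
      refine hS.comp_mem h (h a.1 a.2.1).choose_spec hp rfl e.2.1 rfl hc ?_
      rw [AllPaths.length_map]
      exact hl

/-- An injective parametrization of an orbit by the vertices of a quiver with one arrow
`m ⟶ succ m` for each vertex `m`, compatible with `succ` and `nextVertex`, is an isomorphism of
quivers. -/
theorem exists_quiverIso_of_param (hS : SubpathClosed S) (h : HasDominatingPaths S)
    (i : Quotient (orbitSetoid (nextVertex hS))) {M : Type} [Quiver.{0} M] {succ : M → M}
    (hM : IsSuccQuiver M succ) (u : M → {a : V // AllPaths.vertex a ∈ S})
    (hu : Function.Injective u) (hsucc : ∀ m, u (succ m) = nextVertex hS (u m))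
    (hrange : ∀ b, b ∈ Set.range u ↔ Quotient.mk _ b = i)
    (harrow : ∀ m, ∃ e ∈ S, e.1 = (u m).1 ∧ e.length = 1) :
    ∃ F : M ⥤q (orbitSubquiver hS h i).Vert, IsQuiverIso F ∧ ∀ m, (F.obj m).1 = (u m).1 := by
  have hex : ∀ {a b : M}, (a ⟶ b) → ∃ e : (u a).1 ⟶ (u b).1,
      (⟨_, _, e.toPath⟩ : AllPaths V) ∈ S := by
    intro a b f
    obtain rfl := (hM.nonempty_hom_iff a b).1 ⟨f⟩
    obtain ⟨e, he, hea, heb, hl⟩ := exists_arrow_nextVertex hS (harrow a)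
    obtain ⟨e', he'⟩ := e.eq_toPath_of_length hl
    rw [he'] at he
    rw [hsucc, ← hea, ← heb]
    exact ⟨e', he⟩
  choose arr harr using @hex
  have hmem : ∀ m, ∃ hm : AllPaths.vertex (u m).1 ∈ S, Quotient.mk _ ⟨(u m).1, hm⟩ = i :=
    fun m => ⟨(u m).2, (hrange _).1 ⟨m, rfl⟩⟩
  refine ⟨{ obj m := ⟨(u m).1, hmem m⟩, map {a b} f := ⟨arr f, harr f, hmem a⟩ },
    ⟨⟨fun m n hmn => ?_, ?_⟩, fun a b => ⟨fun f g _ => ?_, ?_⟩⟩, fun m => rfl⟩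
  · exact hu (Subtype.ext (congrArg (fun a : (orbitSubquiver hS h i).Vert => a.1) hmn))
  · rintro ⟨b, hb, hbi⟩
    obtain ⟨m, hm⟩ := (hrange _).2 hbi
    exact ⟨m, Subtype.ext (congrArg (fun a : {a : V // AllPaths.vertex a ∈ S} => a.1) hm)⟩
  · exact (hM.subsingleton a b).elim f g
  · rintro ⟨e, he, -⟩
    have h1 := nextVertex_src hS h he rfl
    have h2 : nextVertex hS (u a) = u b := h1
    rw [← hsucc] at h2
    obtain ⟨f⟩ := (hM.nonempty_hom_iff a b).2 (hu h2).symm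
    refine ⟨f, Subtype.ext ?_⟩
    have h3 := hS.eq_of_src_eq h (harr f) he rfl rfl
    rw [Sigma.mk.injEq] at h3
    have h4 := eq_of_heq h3.2
    rw [Sigma.mk.injEq] at h4
    exact eq_of_heq (Quiver.Path.hom_heq_of_cons_eq_cons (eq_of_heq h4.2))

variable (K : Type u) [Field K]

theorem orbitSubquiver_isDisjointUnion (hS : SubpathClosed S) (h : HasDominatingPaths S) :
    (spanPaths K S hS).subquiver.IsDisjointUnion (orbitSubquiver hS h) where
  disjoint i j hij := by
    rw [Set.disjoint_left]
    rintro a ⟨_, rfl⟩ ⟨_, rfl⟩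
    exact hij rfl
  verts_eq := by
    ext a
    rw [Set.mem_iUnion]
    refine (mem_paths_spanPaths K hS (.vertex a)).trans ⟨fun ha => ⟨_, ha, rfl⟩, ?_⟩
    rintro ⟨i, ha, -⟩
    exact ha
  arrows_eq a b := by
    ext e
    rw [Set.mem_iUnion]
    refine (mem_paths_spanPaths K hS ⟨a, b, e.toPath⟩).trans
      ⟨fun he => ⟨_, he, hS.src_mem he, rfl⟩, ?_⟩
    rintro ⟨i, he, -⟩
    exact he

/-- An isomorphism of quivers which matches two sets of paths carries the span of the first onto the
span of the second. -/
theorem component_eq_map (hS : SubpathClosed S) (H : Subquiver V) {M : Type x} [Quiver.{y} M]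
    {D : Subcoalgebra K (PathCoalgebra K M)} {T : Set (AllPaths M)}
    (hD : D.toSubmodule = Submodule.span K ((fun p => ofPath K p.2.2) '' T))
    {F : M ⥤q H.Vert} (hF : IsQuiverIso F)
    (hFT : ∀ p, (p.map F).map H.incl ∈ S ↔ p ∈ T) :
    ((spanPaths K S hS).component H).toSubmodule =
      D.toSubmodule.map (PathCoalgebra.map K F) := by
  change Submodule.span K _ = _
  rw [hD, Submodule.map_span, Set.image_image]
  congr 1
  ext z
  constructor
  · rintro ⟨p, hp, rfl⟩
    obtain ⟨p, rfl⟩ := hF.map_surjective p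
    refine ⟨p, (hFT p).1 ((mem_paths_spanPaths K hS _).1 hp), ?_⟩
    exact map_ofPath K F p.2.2
  · rintro ⟨p, hp, rfl⟩
    refine ⟨p.map F, (mem_paths_spanPaths K hS ((p.map F).map H.incl)).2 ((hFT p).2 hp), ?_⟩
    exact (map_ofPath K F p.2.2).symm

end Decomposition

section DecompositionExists

variable {V : Type v} [Quiver.{w} V] {S : Set (AllPaths V)}

/-- A function on a finite cycle which does not decrease along the cycle is constant. -/
theorem ZMod.eq_of_le_add_one {n : ℕ} [NeZero n] (g : ZMod n → ℕ) (hg : ∀ k, g k ≤ g (k + 1))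
    (k l : ZMod n) : g k = g l := by
  have h1 : ∀ (k : ZMod n) (j : ℕ), g k ≤ g (k + j) := by
    intro k j
    induction j with
    | zero => simp
    | succ j ih =>
      refine ih.trans ((hg _).trans_eq ?_)
      rw [Nat.cast_succ, add_assoc]
  have h2 : ∀ k l : ZMod n, g k ≤ g l := by
    intro k l
    have := h1 k (l - k).val
    rwa [ZMod.natCast_zmod_val, add_sub_cancel] at this
  exact le_antisymm (h2 k l) (h2 l k)

/-- Every orbit of `nextVertex` is a model quiver, and the corresponding component is the image of a
model coalgebra: the type is determined by whether the orbit has an arrow, a source, or a period,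
and the model coalgebra by the lengths of the dominating paths. -/
theorem exists_modelType (K : Type u) [Field K] (hS : SubpathClosed S) (h : HasDominatingPaths S)
    (i : Quotient (orbitSetoid (nextVertex hS))) :
    ∃ (t : ModelType) (F : t.Vert ⥤q (orbitSubquiver hS h i).Vert), IsQuiverIso F ∧
      ((spanPaths K S hS).component (orbitSubquiver hS h i)).toSubmodule =
        (t.coalgebra K).toSubmodule.map (PathCoalgebra.map K F) := by
  obtain ⟨a, rfl⟩ := Quotient.exists_rep i
  set i : Quotient (orbitSetoid (nextVertex hS)) := Quotient.mk _ a
  have hinj := nextVertex_injective hS h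
  have hclass : ∀ b, Quotient.mk _ b = i ↔ orbitSetoid (nextVertex hS) b a := fun b =>
    Quotient.eq
  by_cases harr : ∀ b, Quotient.mk _ b = i → ∃ e ∈ S, e.1 = b.1 ∧ e.length = 1
  · have hpos : ∀ b, Quotient.mk _ b = i → 1 ≤ maxLength h b := by
      rintro ⟨b, hb⟩ hbi
      obtain ⟨e, he, rfl, hl⟩ := harr _ hbi
      exact hl.symm.le.trans (length_le_maxLength hS h he)
    have hmem : ∀ {M : Type} [Quiver.{0} M] (u : M → {a : V // AllPaths.vertex a ∈ S})
        (F : M ⥤q (orbitSubquiver hS h i).Vert), (∀ m, (F.obj m).1 = (u m).1) →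
        ∀ p : AllPaths M, (p.map F).map (orbitSubquiver hS h i).incl ∈ S ↔
          p.length ≤ maxLength h (u p.1) := by
      intro M _ u F hF p
      rw [map_incl_mem_iff, AllPaths.length_map]
      have : (⟨(p.map F).1.1, (p.map F).1.2.1⟩ : {a : V // AllPaths.vertex a ∈ S}) = u p.1 :=
        Subtype.ext (hF p.1)
      rw [this]
    by_cases hsurj : ∀ b, orbitSetoid (nextVertex hS) b a → b ∈ Set.range (nextVertex hS)
    · by_cases hper : ∃ k, 0 < k ∧ (nextVertex hS)^[k] a = a
      · obtain ⟨k, hk, hka⟩ := hper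
        obtain ⟨n, hn, u, hu⟩ := exists_param_zmod hinj hk hka
        have : NeZero n := ⟨by omega⟩
        have hui : ∀ k, Quotient.mk _ (u k) = i := fun k =>
          (hclass _).2 ((hu.mem_range_iff _).1 ⟨k, rfl⟩)
        have hconst := ZMod.eq_of_le_add_one (fun k => maxLength h (u k)) fun k => by
          rw [hu.map_add_one]
          exact maxLength_le_nextVertex hS h _
        let u' : CycleQuiver n → {a : V // AllPaths.vertex a ∈ S} := fun m => u m.idx
        obtain ⟨F, hF, hFu⟩ := exists_quiverIso_of_param hS h i (CycleQuiver.isSuccQuiver n) u'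
          (fun m m' hm => congrArg CycleQuiver.mk (hu.injective hm)) (fun m => hu.map_add_one _)
          (fun b => by
            rw [hclass, ← hu.mem_range_iff]
            exact ⟨fun ⟨m, hm⟩ => ⟨m.idx, hm⟩, fun ⟨m, hm⟩ => ⟨⟨m⟩, hm⟩⟩)
          fun m => harr _ (hui _)
        refine ⟨.cycle n (maxLength h (u 0)) hn (hpos _ (hui _)), F, hF, ?_⟩
        refine component_eq_map K hS _ rfl hF fun p => (hmem u' F hFu p).trans ?_
        change p.length ≤ maxLength h (u p.1.idx) ↔ p.length ≤ maxLength h (u 0)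
        rw [hconst p.1.idx 0]
      · obtain ⟨u, hu⟩ := exists_param_int hinj hsurj fun k hk hka => hper ⟨k, hk, hka⟩
        have hui : ∀ k, Quotient.mk _ (u k) = i := fun k =>
          (hclass _).2 ((hu.mem_range_iff _).1 ⟨k, rfl⟩)
        let u' : LineQuiver → {a : V // AllPaths.vertex a ∈ S} := fun m => u m.idx
        obtain ⟨F, hF, hFu⟩ := exists_quiverIso_of_param hS h i LineQuiver.isSuccQuiver u'
          (fun m m' hm => congrArg LineQuiver.mk (hu.injective hm)) (fun m => hu.map_add_one _)
          (fun b => by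
            rw [hclass, ← hu.mem_range_iff]
            exact ⟨fun ⟨m, hm⟩ => ⟨m.idx, hm⟩, fun ⟨m, hm⟩ => ⟨⟨m⟩, hm⟩⟩)
          fun m => harr _ (hui _)
        have hr : StrictMono fun z => z + (maxLength h (u z) : ℤ) := by
          refine strictMono_int_of_lt_succ fun z => ?_
          have := maxLength_le_nextVertex hS h (u z)
          rw [hu.map_add_one]
          omega
        refine ⟨.line _ hr fun z => ?_, F, hF, ?_⟩
        · have := hpos _ (hui z)
          change z < z + (maxLength h (u z) : ℤ)
          omega
        · refine component_eq_map K hS _ rfl hF fun p => (hmem u' F hFu p).trans ?_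
          change p.length ≤ maxLength h (u p.1.idx) ↔
            (p.length : ℤ) ≤ p.1.idx + (maxLength h (u p.1.idx) : ℤ) - p.1.idx
          omega
    · push Not at hsurj
      obtain ⟨b, hba, hb⟩ := hsurj
      obtain ⟨u, hu⟩ := exists_param_nat hinj hba hb
      have hui : ∀ k, Quotient.mk _ (u k) = i := fun k =>
        (hclass _).2 ((hu.mem_range_iff _).1 ⟨k, rfl⟩)
      let u' : RayQuiver → {a : V // AllPaths.vertex a ∈ S} := fun m => u m.idx
      obtain ⟨F, hF, hFu⟩ := exists_quiverIso_of_param hS h i RayQuiver.isSuccQuiver u'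
        (fun m m' hm => congrArg RayQuiver.mk (hu.injective hm)) (fun m => hu.map_add_one _)
        (fun b => by
          rw [hclass, ← hu.mem_range_iff]
          exact ⟨fun ⟨m, hm⟩ => ⟨m.idx, hm⟩, fun ⟨m, hm⟩ => ⟨⟨m⟩, hm⟩⟩)
        fun m => harr _ (hui _)
      have hr : StrictMono fun z => z + maxLength h (u z) := by
        refine strictMono_nat_of_lt_succ fun z => ?_
        have := maxLength_le_nextVertex hS h (u z)
        rw [hu.map_add_one]
        omega
      refine ⟨.ray _ hr ((hpos _ (hui 0)).trans (Nat.le_add_left _ _)), F, hF, ?_⟩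
      refine component_eq_map K hS _ rfl hF fun p => (hmem u' F hFu p).trans ?_
      change p.length ≤ maxLength h (u p.1.idx) ↔
        p.1.idx + p.length ≤ p.1.idx + maxLength h (u p.1.idx)
      omega
  · -- A vertex without arrows is fixed by `nextVertex`, so that it is the whole orbit.
    push Not at harr
    obtain ⟨b, hbi, hb⟩ := harr
    have hb' : ¬∃ e ∈ S, e.1 = b.1 ∧ e.length = 1 := fun ⟨e, he, hs, hl⟩ => hb e he hs hl
    have hfix := nextVertex_of_forall hS hb'
    have hiter : ∀ n, (nextVertex hS)^[n] b = b := fun n => Function.iterate_fixed hfix n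
    have huniq : ∀ c, Quotient.mk _ c = i → c = b := by
      intro c hc
      obtain ⟨m, n, hmn⟩ := Quotient.exact (s := orbitSetoid _) (hc.trans hbi.symm)
      rw [hiter] at hmn
      exact hinj.iterate m (hmn.trans (hiter m).symm)
    have huniq' : ∀ c : (orbitSubquiver hS h i).Vert, c = ⟨b.1, b.2, hbi⟩ := fun c =>
      Subtype.ext (congrArg (fun a : {a : V // AllPaths.vertex a ∈ S} => a.1)
        (huniq _ c.2.choose_spec))
    have hnone : ∀ c d : (orbitSubquiver hS h i).Vert, IsEmpty (c ⟶ d) := by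
      intro c d
      rw [huniq' c]
      exact ⟨fun e => hb _ e.2.1 rfl rfl⟩
    let F : PointQuiver ⥤q (orbitSubquiver hS h i).Vert :=
      { obj _ := ⟨b.1, b.2, hbi⟩, map e := e.elim }
    have hF : IsQuiverIso F := by
      refine ⟨⟨fun ⟨⟩ ⟨⟩ _ => rfl, fun c => ⟨.pt, (huniq' c).symm⟩⟩, fun c d => ⟨?_, ?_⟩⟩
      · exact fun e => e.elim
      · exact fun e => ((hnone _ _).false e).elim
    refine ⟨.point, F, hF, component_eq_map K hS _ rfl hF fun p => ⟨fun _ => trivial, fun _ => ?_⟩⟩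
    refine (map_incl_mem_iff hS h i _).2 ((AllPaths.length_map F p).trans_le ?_)
    obtain ⟨c, d, p⟩ := p
    cases p with
    | nil => exact Nat.zero_le _
    | cons _ e => exact e.elim

theorem exists_decomposition {K : Type u} [Field K] {C : Subcoalgebra K (PathCoalgebra K V)}
    (hC : IsPathSubcoalgebra C) (hco : IsLeftCoFrobenius K C.toSubmodule) :
    ∃ (ι : Type v) (H : ι → Subquiver V) (t : ι → ModelType), IsDecomposition C H t ∧
      ∀ i, ∃ F : (t i).Vert ⥤q (H i).Vert, IsQuiverIso F ∧
        (C.component (H i)).toSubmodule =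
          ((t i).coalgebra K).toSubmodule.map (PathCoalgebra.map K F) := by
  obtain ⟨S, hS, rfl⟩ := hC.eq_spanPaths
  have h := hasDominatingPaths_of_isLeftCoFrobenius hS hco
  choose t F hF hFC using exists_modelType K hS h
  refine ⟨_, orbitSubquiver hS h, t, ⟨orbitSubquiver_isDisjointUnion K hS h,
    fun i => ⟨F i, hF i⟩, fun i => ?_⟩, fun i => ⟨F i, hF i, hFC i⟩⟩
  exact Subcoalgebra.nonempty_equiv_of_map_eq (PathCoalgebra.mapHom K (F i))
    (PathCoalgebra.mapHom_injective K (F i) (hF i).map_injective) _ _ (hFC i)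

end DecompositionExists

theorem mainTheorem2 {K : Type u} {V : Type v} [Field K] [Quiver.{w} V]
    (C : Subcoalgebra K (PathCoalgebra K V)) (hC : IsPathSubcoalgebra C) :
    (IsLeftCoFrobenius K C.toSubmodule ↔
      ∃ (ι : Type v) (H : ι → Subquiver V) (t : ι → ModelType), IsDecomposition C H t) ∧
    (IsLeftCoFrobenius K C.toSubmodule →
      ∃ (ι : Type v) (H : ι → Subquiver V) (t : ι → ModelType), IsDecomposition C H t ∧
        ∀ i, ∃ F : (t i).Vert ⥤q (H i).Vert, IsQuiverIso F ∧
          (C.component (H i)).toSubmodule =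
            ((t i).coalgebra K).toSubmodule.map (PathCoalgebra.map K F)) ∧
    (∀ (ι : Type x) [DecidableEq ι] (H : ι → Subquiver V) (t : ι → ModelType),
      IsDecomposition C H t →
        (∃ Φ : (Π₀ i, (C.component (H i)).toSubmodule) ≃ₗc[K] C.toSubmodule,
          ∀ (i : ι) (c : (C.component (H i)).toSubmodule),
            (Φ (DFinsupp.single i c) : PathCoalgebra K V) =
              PathCoalgebra.map K (H i).incl c) ∧
        Nonempty (C.toSubmodule ≃ₗc[K] Π₀ i, ((t i).coalgebra K).toSubmodule)) := by
  refine ⟨⟨fun hco => ?_, fun ⟨ι, H, t, h⟩ => h.isLeftCoFrobenius hC⟩,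
    exists_decomposition hC, fun ι _ H t h =>
      ⟨exists_directSum_equiv hC h.disjointUnion, h.nonempty_equiv hC⟩⟩
  obtain ⟨ι, H, t, h, -⟩ := exists_decomposition hC hco
  exact ⟨ι, H, t, h⟩
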